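/- **Conventions.** "Operad" means planar, single-colored operad in sets: sets $\mathcal X(n)$ ($n\ge 0$), an identity $\mathrm{id}\in\mathcal X(1)$ and compositions $\gamma:\mathcal X(n)\times\mathcal X(k_1)\times\dots\times\mathcal X(k_n)\to\mathcal X(k_1+\dots+k_n)$, associative and unital. Let $\mathfrak S$ be the operad of permutation groups, $\mathfrak S(n)=\mathfrak S_n$, where $\gamma(\sigma;\tau_1,\dots,\tau_n)$ permutes the $i$-th block by $\tau_i$ and then moves it to the $\sigma(i)$-th position. For an operad $\mathcal Y$ over $\mathfrak S$ and $y\in\mathcal Y(n)$, write $\bar y\in\mathfrak S_n$ for its image. *Monoid operads and group operads.* The category $\mathbf{Op}^{/\mathfrak S}$ of operads over $\mathfrak S$ is monoidal: $(\mathcal X\rtimes\mathcal Y)(n)=\mathcal X(n)\times\mathcal Y(n)$ with structure map $(x,y)\mapsto \bar x\,\bar y$, identity $(\mathrm{id},\mathrm{id})$ and composition $$\gamma\big((x,y);(x_1,y_1),\dots,(x_n,y_n)\big)=\big(\gamma(x;x_{\bar y^{-1}(1)},\dots,x_{\bar y^{-1}(n)}),\ \gamma(y;y_1,\dots,y_n)\big);$$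 the unit object is the trivial operad $\ast$, mapped to the units of $\mathfrak S_n$. Its monoid objects are the *monoid operads*; they form the category $\mathbf{MonOp}$. A *group operad* is an operad $\mathcal G$ over $\mathfrak S$ with group structures on all $\mathcal G(n)$ such that $\mathcal G(n)\to\mathfrak S_n$ are group homomorphisms and $$\gamma(xy;x_1y_1,\dots,x_ny_n)=\gamma(x;x_{\bar y^{-1}(1)},\dots,x_{\bar y^{-1}(n)})\,\gamma(y;y_1,\dots,y_n).$$ With the maps of operads over $\mathfrak S$ that are levelwise group homomorphisms, they form the category $\mathbf{GrpOp}$, and there is an evident functor $\mathbf{GrpOp}\to\mathbf{MonOp}$. *Crossed interval groups and monoids.* Let $\nabla$ be the category with objects $\langle\!\langle n\rangle\!\rangle=\{-\infty<1<\dots<n<\infty\}$, $n\ge 0$, and with order-preserving maps fixing $\pm\infty$ as morphisms. For $\varphi:\langle\!\langle m\rangle\!\rangle\to\langle\!\langle n\rangle\!\rangle$ let $k_j=k_j^{(\varphi)}$ be the number of elements of $\varphi^{-1}\{j\}$ other than $\pm\infty$. Interval sets are presheaves of sets on $\nabla$; their category is $\mathbf{Set}_\nabla$. A *crossed interval group*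 is an interval set $G$ with a group structure on each $G_n$ and left actions $(g,\varphi)\mapsto\varphi^g$ of $G_n$ on the sets $\nabla(\langle\!\langle m\rangle\!\rangle,\langle\!\langle n\rangle\!\rangle)$ such that $(\varphi\psi)^g=\varphi^g\psi^{\varphi^*(g)}$ and $\varphi^*(gh)=(\varphi^h)^*(g)\,\varphi^*(h)$. With the maps of interval sets that are levelwise group homomorphisms and respect the actions, these form the category $\mathbf{CrsGrp}_\nabla$. For a crossed interval group $W$, the category $\mathbf{Set}_\nabla^{/W}$ of interval sets over $W$ is monoidal: $(X\rtimes Y)_n=X_n\times Y_n$, $\varphi^*(x,y)=((\varphi^{\bar y})^*(x),\varphi^*(y))$, with structure map $(x,y)\mapsto\bar x\,\bar y$, where the bar is the image in $W$; the unit object is the one-point interval set, mapped to the units. Let $\mathfrak W_\nabla$ be the following crossed interval group. Put $(\mathfrak W_\nabla)_n=(\mathfrak S_n\ltimes(\mathbb Z/2)^n)\times\mathbb Z/2$, with $$(\tau;y_1,\dots,y_n;v)(\sigma;x_1,\dots,x_n;u)=(\tau\sigma;y_{\sigma(1)}x_1,\dots,y_{\sigma(n)}x_n;vu),$$ and, with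 $\beta_k\in\mathfrak S_k$ the order reversion and $x_{\pm\infty}=u$, $$\varphi^*(\sigma;x_1,\dots,x_n;u)=\big(\gamma(\beta_3^u;\beta^u_{k_{-\infty}},\gamma(\sigma;\beta^{x_1}_{k_1},\dots,\beta^{x_n}_{k_n}),\beta^u_{k_\infty});x_{\varphi(1)},\dots,x_{\varphi(m)};u\big).$$ The action is the one for which $\varphi^{(\sigma;x;u)}$ has the numbers $j\mapsto k^{(\varphi)}_{\sigma^{-1}(j)}$ and $\pm\infty\mapsto k^{(\varphi)}_{\pm u\infty}$. The elements $(\sigma;1,\dots,1;1)$ form a crossed interval subgroup, again denoted by $\mathfrak S$. *Crossed interval monoids* are the monoid objects of $(\mathbf{Set}_\nabla^{/\mathfrak W_\nabla},\rtimes)$; they form the category $\mathbf{CrsMon}_\nabla$. The inclusion $\mathfrak S\to\mathfrak W_\nabla$ makes $\mathfrak S$ a crossed interval monoid, and there is an evident functor $\mathbf{CrsGrp}_\nabla^{/\mathfrak S}\to\mathbf{CrsMon}_\nabla^{/\mathfrak S}$ between the slice categories over $\mathfrak S$. *The functor $\Psi$.* For an operad $\mathcal X$ with a map $\ast\to\mathcal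 X$, given by elements $e_n\in\mathcal X(n)$, let $\Psi(\mathcal X)$ be the interval set with $\Psi(\mathcal X)_n=\mathcal X(n)$ and $$\varphi^*(x)=\gamma\big(e_3;e_{k_{-\infty}},\gamma(x;e_{k_1},\dots,e_{k_n}),e_{k_\infty}\big).$$ For $\mathfrak S$ with the units, this is the underlying interval set of the crossed interval group $\mathfrak S$. So $\Psi$ induces a functor $\Psi^{\mathfrak S}$ from pointed operads over $\mathfrak S$ to interval sets over $\mathfrak S$, and $\Psi^{\mathfrak S}$ is strictly monoidal for $\rtimes$ on the pointed operads over $\mathfrak S$ whose base points $e_n$ map to the units. **Theorem.** The functor $\Psi^{\mathfrak S}$ induces a functor $$\widehat\Psi:\mathbf{MonOp}\to\mathbf{CrsMon}_\nabla^{/\mathfrak S},$$ which sends a monoid operad $\mathcal X$, pointed by its unit $\ast\to\mathcal X$, to $\Psi^{\mathfrak S}(\mathcal X)$ with the multiplication $\Psi^{\mathfrak S}(\mathcal X)\rtimes\Psi^{\mathfrak S}(\mathcal X)=\Psi^{\mathfrak S}(\mathcal X\rtimes\mathcal X)\to\Psi^{\mathfrak S}(\mathcal X)$ and the unit $\ast=\Psi^{\mathfrak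 S}(\ast)\to\Psi^{\mathfrak S}(\mathcal X)$. The functor $\widehat\Psi$ is fully faithful. It restricts, along $\mathbf{GrpOp}\to\mathbf{MonOp}$ and $\mathbf{CrsGrp}_\nabla^{/\mathfrak S}\to\mathbf{CrsMon}_\nabla^{/\mathfrak S}$, to a fully faithful functor $\mathbf{GrpOp}\to\mathbf{CrsGrp}_\nabla^{/\mathfrak S}$ (the square commutes up to natural isomorphism), and this functor has a left adjoint. -/

import Mathlib

open CategoryTheory MonoidalCategory Opposite

universe v u

namespace CrossedInterval

/-! ### Concatenation of finite linear orders -/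

/-- The canonical order isomorphism between the join `Fin (k 0) ⋆ ⋯ ⋆ Fin (k (n - 1))` and
`Fin m`, where `m = ∑ i, k i`: it sends `⟨i, a⟩` to `k 0 + ⋯ + k (i - 1) + a`. -/
def flat {n m : ℕ} (k : Fin n → ℕ) (h : ∑ i, k i = m) : (Σ i, Fin (k i)) ≃ Fin m :=
  finSigmaFinEquiv.trans (finCongr h)

theorem flat_val {n m : ℕ} (k : Fin n → ℕ) (h : ∑ i, k i = m) (i : Fin n) (a : Fin (k i)) :
    (flat k h ⟨i, a⟩ : ℕ) = ∑ j, (if j < i then k j else 0) + a := by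
  have : (flat k h ⟨i, a⟩ : ℕ) = ∑ j : Fin i, k (Fin.castLE i.2.le j) + a := by
    simp [flat]
  rw [this]
  congr 1
  rw [← Finset.sum_filter]
  symm
  refine Finset.sum_bij' (fun j hj => ⟨j.1, by simpa using hj⟩) (fun j _ => Fin.castLE i.2.le j)
    ?_ ?_ ?_ ?_ ?_ <;> intros <;> simp [Fin.lt_def, -Fin.val_fin_lt]

theorem flat_congr {n m : ℕ} {k k' : Fin n → ℕ} (hk : k = k') (h : ∑ i, k i = m)
    (h' : ∑ i, k' i = m) (i : Fin n) (a : Fin (k i)) :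
    flat k h ⟨i, a⟩ = flat k' h' ⟨i, Fin.cast (congrFun hk i) a⟩ := by
  subst hk; rfl

theorem flat_lt_of_lt {n m : ℕ} (k : Fin n → ℕ) (h : ∑ i, k i = m) {i j : Fin n} (hij : i < j)
    (a : Fin (k i)) (b : Fin (k j)) : flat k h ⟨i, a⟩ < flat k h ⟨j, b⟩ := by
  rw [Fin.lt_def, flat_val, flat_val]
  have h1 : ∑ l, (if l < i then k l else 0) + k i ≤ ∑ l, (if l < j then k l else 0) := by
    have : k i = ∑ l, (if l = i then k l else 0) := by simp
    rw [this, ← Finset.sum_add_distrib]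
    refine Finset.sum_le_sum fun l _ => ?_
    split_ifs <;> omega
  have := a.2
  omega

theorem flat_lt_iff {n m : ℕ} (k : Fin n → ℕ) (h : ∑ i, k i = m) (i j : Fin n)
    (a : Fin (k i)) (b : Fin (k j)) :
    flat k h ⟨i, a⟩ < flat k h ⟨j, b⟩ ↔ i < j ∨ (i = j ∧ (a : ℕ) < b) := by
  rcases lt_trichotomy i j with hij | rfl | hij
  · simp [hij, flat_lt_of_lt k h hij a b]
  · rw [Fin.lt_def, flat_val, flat_val]; simp
  · have := (flat_lt_of_lt k h hij b a).not_gt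
    simp [this, hij.not_gt, hij.ne']

theorem flat_sum {n m : ℕ} (k : Fin n → ℕ) (h : ∑ i, k i = m) (l : Fin m → ℕ) :
    ∑ i, ∑ a, l (flat k h ⟨i, a⟩) = ∑ p, l p := by
  rw [← (flat k h).sum_comp, Fintype.sum_sigma]

theorem flat_flat {n m M : ℕ} (k : Fin n → ℕ) (h : ∑ i, k i = m) (l : Fin m → ℕ)
    (hl : ∑ p, l p = M) (q : Fin n → ℕ) (hq : ∑ i, q i = M)
    (hi : ∀ i, ∑ a, l (flat k h ⟨i, a⟩) = q i) (i : Fin n) (a : Fin (k i))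
    (c : Fin (l (flat k h ⟨i, a⟩))) :
    flat l hl ⟨flat k h ⟨i, a⟩, c⟩ =
      flat q hq ⟨i, flat (fun b => l (flat k h ⟨i, b⟩)) (hi i) ⟨a, c⟩⟩ := by
  ext
  rw [flat_val, flat_val, flat_val, ← flat_sum k h, ← add_assoc]
  congr 1
  have : (∑ b, if b < a then l (flat k h ⟨i, b⟩) else 0) =
      ∑ j, if j = i then ∑ b, (if flat k h ⟨j, b⟩ < flat k h ⟨i, a⟩ then
        l (flat k h ⟨j, b⟩) else 0) else 0 := by
    simp [flat_lt_iff]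
  rw [this, ← Finset.sum_add_distrib]
  refine Finset.sum_congr rfl fun j _ => ?_
  rcases lt_trichotomy j i with hij | rfl | hij
  · simp [flat_lt_iff, hij, hij.ne, hi]
  · simp
  · simp [flat_lt_iff, hij.not_gt, hij.ne']

theorem flat_one {m : ℕ} (h : ∑ _i : Fin 1, m = m) (i : Fin 1) (a : Fin m) :
    flat (fun _ => m) h ⟨i, a⟩ = a := by
  ext; rw [flat_val]; simp [Subsingleton.elim _ i]

theorem flat_ones {m : ℕ} (h : ∑ _i : Fin m, 1 = m) (i : Fin m) (a : Fin 1) :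
    flat (fun _ => 1) h ⟨i, a⟩ = i := by
  ext; rw [flat_val]; simp [Finset.filter_gt_eq_Iio]

theorem flat_rev {n m : ℕ} (k : Fin n → ℕ) (h : ∑ i, k i = m)
    (h' : ∑ i, k (Fin.rev i) = m) (i : Fin n) (a : Fin (k (Fin.rev i))) :
    Fin.rev (flat (fun i => k (Fin.rev i)) h' ⟨i, a⟩) = flat k h ⟨Fin.rev i, Fin.rev a⟩ := by
  ext
  rw [Fin.val_rev, flat_val, flat_val, Fin.val_rev]
  have e1 : ∑ j, (if j < Fin.rev i then k j else 0) =
      ∑ j, (if i < j then k (Fin.rev j) else 0) := by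
    rw [← Equiv.sum_comp Fin.revPerm]; simp [Fin.rev_lt_rev]
  have e2 : ∑ j, (if j < i then k (Fin.rev j) else 0) + k (Fin.rev i) +
      ∑ j, (if i < j then k (Fin.rev j) else 0) = m := by
    have : k (Fin.rev i) = ∑ j, (if j = i then k (Fin.rev j) else 0) := by simp
    rw [this, ← Finset.sum_add_distrib, ← Finset.sum_add_distrib, ← h']
    refine Finset.sum_congr rfl fun j _ => ?_
    rcases lt_trichotomy j i with hij | rfl | hij
    · simp [hij, hij.ne, hij.not_gt]
    · simp
    · simp [hij, hij.ne', hij.not_gt]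
  rw [e1]
  have := a.2
  omega

/-! ### Permutations -/

/-- The composition `γ(σ; τ₁, …, τₙ)` of permutations: first permute the `i`-th block of length
`k i` by `τ i`, then move the `i`-th block to the `σ i`-th position. -/
def permComp {n m : ℕ} (k : Fin n → ℕ) (h : ∑ i, k i = m) (σ : Equiv.Perm (Fin n))
    (τ : ∀ i, Equiv.Perm (Fin (k i))) : Equiv.Perm (Fin m) :=
  (((flat k h).symm.trans (Equiv.sigmaCongrRight τ)).trans
    (Equiv.sigmaCongrLeft (β := fun i => Fin (k i)) σ⁻¹).symm).trans
    (flat (fun j => k (σ⁻¹ j)) ((Equiv.sum_comp σ⁻¹ k).trans h))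

theorem permComp_inv {n m : ℕ} (k : Fin n → ℕ) (h : ∑ i, k i = m) (σ : Equiv.Perm (Fin n))
    (τ : ∀ i, Equiv.Perm (Fin (k i))) (h' : ∑ j, k (σ⁻¹ j) = m) (j : Fin n)
    (b : Fin (k (σ⁻¹ j))) :
    (permComp k h σ τ)⁻¹ (flat (fun j => k (σ⁻¹ j)) h' ⟨j, b⟩) =
      flat k h ⟨σ⁻¹ j, (τ (σ⁻¹ j))⁻¹ b⟩ := by
  rw [Equiv.Perm.inv_eq_iff_eq]
  simp only [permComp, Equiv.trans_apply, Equiv.symm_apply_apply]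
  congr 1
  rw [Equiv.eq_symm_apply]
  simp [Equiv.sigmaCongrLeft]

/-- A permutation is determined by its inverse on concatenated elements. -/
theorem perm_ext_flat {n m : ℕ} (k : Fin n → ℕ) (h : ∑ i, k i = m) {π π' : Equiv.Perm (Fin m)}
    (H : ∀ i a, π⁻¹ (flat k h ⟨i, a⟩) = π'⁻¹ (flat k h ⟨i, a⟩)) : π = π' := by
  rw [← inv_inj]
  ext p : 1
  obtain ⟨⟨i, a⟩, rfl⟩ := (flat k h).surjective p
  exact H i a

theorem permComp_assoc {n m M : ℕ} (k : Fin n → ℕ) (h : ∑ i, k i = m) (l : Fin m → ℕ)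
    (hl : ∑ p, l p = M) (q : Fin n → ℕ) (hq : ∑ i, q i = M)
    (hi : ∀ i, ∑ a, l (flat k h ⟨i, a⟩) = q i) (σ : Equiv.Perm (Fin n))
    (τ : ∀ i, Equiv.Perm (Fin (k i))) (υ : ∀ p, Equiv.Perm (Fin (l p))) :
    permComp l hl (permComp k h σ τ) υ =
      permComp q hq σ (fun i => permComp (fun a => l (flat k h ⟨i, a⟩)) (hi i) (τ i)
        (fun a => υ (flat k h ⟨i, a⟩))) := by
  have hk' : ∑ j, k (σ⁻¹ j) = m := (Equiv.sum_comp σ⁻¹ k).trans h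
  have hq' : ∑ j, q (σ⁻¹ j) = M := (Equiv.sum_comp σ⁻¹ q).trans hq
  have hl' : ∑ p, l ((permComp k h σ τ)⁻¹ p) = M := (Equiv.sum_comp (permComp k h σ τ)⁻¹ l).trans hl
  refine perm_ext_flat _ hq' fun j d => ?_
  have hd : ∑ b, l (flat k h ⟨σ⁻¹ j, (τ (σ⁻¹ j))⁻¹ b⟩) = q (σ⁻¹ j) :=
    (Equiv.sum_comp (τ (σ⁻¹ j))⁻¹ fun b => l (flat k h ⟨σ⁻¹ j, b⟩)).trans (hi _)
  obtain ⟨⟨b, c⟩, rfl⟩ := (flat _ hd).surjective d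
  rw [permComp_inv, permComp_inv, ← flat_flat k h l hl q hq hi]
  have hb : (fun b => l (flat k h ⟨σ⁻¹ j, (τ (σ⁻¹ j))⁻¹ b⟩)) =
      fun b => l ((permComp k h σ τ)⁻¹ (flat _ hk' ⟨j, b⟩)) := by
    funext b; rw [permComp_inv]
  have hd' : ∀ j, ∑ b, l ((permComp k h σ τ)⁻¹ (flat _ hk' ⟨j, b⟩)) = q (σ⁻¹ j) := fun j => by
    simp only [permComp_inv]
    exact (Equiv.sum_comp (τ (σ⁻¹ j))⁻¹ fun b => l (flat k h ⟨σ⁻¹ j, b⟩)).trans (hi _)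
  rw [flat_congr hb hd (hd' j) b c, ← flat_flat _ hk' _ hl' _ hq' hd', permComp_inv]
  have key : ∀ (r : Fin m) (hr : r = flat k h ⟨σ⁻¹ j, (τ (σ⁻¹ j))⁻¹ b⟩),
      flat l hl ⟨r, (υ r)⁻¹ (Fin.cast (by rw [hr]) c)⟩ =
        flat l hl ⟨flat k h ⟨σ⁻¹ j, (τ (σ⁻¹ j))⁻¹ b⟩, (υ _)⁻¹ c⟩ := by
    intro r hr; subst hr; rfl
  exact key _ (permComp_inv ..)

/-- The interchange law relating the composition and the products of permutations. -/
theorem permComp_mul {n m : ℕ} (k : Fin n → ℕ) (h : ∑ i, k i = m) (σ σ' : Equiv.Perm (Fin n))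
    (τ τ' : ∀ i, Equiv.Perm (Fin (k i))) (h' : ∑ j, k (σ'⁻¹ j) = m) :
    permComp k h (σ * σ') (fun i => τ i * τ' i) =
      permComp (fun i => k (σ'⁻¹ i)) h' σ (fun i => τ (σ'⁻¹ i)) * permComp k h σ' τ' := by
  have hk' : ∑ j, k ((σ * σ')⁻¹ j) = m := (Equiv.sum_comp (σ * σ')⁻¹ k).trans h
  refine perm_ext_flat _ hk' fun j d => ?_
  rw [permComp_inv, mul_inv_rev (permComp _ _ _ _), Equiv.Perm.mul_apply]
  refine Eq.trans ?_ (congrArg _ (permComp_inv (fun i => k (σ'⁻¹ i)) h' σ _ hk' j d).symm)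
  exact (permComp_inv k h σ' τ' h' _ _).symm

theorem permComp_one {n m : ℕ} (k : Fin n → ℕ) (h : ∑ i, k i = m) :
    permComp k h 1 (fun _ => 1) = 1 := by
  refine perm_ext_flat k h fun i a => ?_
  exact permComp_inv k h 1 (fun _ => 1) h i a

theorem permComp_one_left {n : ℕ} (h : ∑ _i : Fin 1, n = n) (σ : Equiv.Perm (Fin n)) :
    permComp (fun _ => n) h 1 (fun _ => σ) = σ := by
  refine perm_ext_flat (fun _ => n) h fun i a => ?_
  refine (permComp_inv (fun _ => n) h 1 (fun _ => σ) h i a).trans ?_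
  rw [flat_one, flat_one]

theorem permComp_one_right {n : ℕ} (h : ∑ _i : Fin n, 1 = n) (σ : Equiv.Perm (Fin n)) :
    permComp (fun _ => 1) h σ (fun _ => 1) = σ := by
  refine perm_ext_flat (fun _ => 1) h fun i a => ?_
  rw [permComp_inv (fun _ => 1) h σ (fun _ => 1) h i a, flat_ones, flat_ones]

theorem permComp_rev {n m : ℕ} (k : Fin n → ℕ) (h : ∑ i, k i = m) :
    permComp k h Fin.revPerm (fun _ => Fin.revPerm) = Fin.revPerm := by
  refine perm_ext_flat (fun i => k (Fin.rev i)) ((Equiv.sum_comp Fin.revPerm k).trans h)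
    fun i a => ?_
  refine (permComp_inv k h Fin.revPerm (fun _ => Fin.revPerm) _ i a).trans ?_
  exact (flat_rev k h _ i a).symm

attribute [irreducible] flat permComp

/-! ### Operads -/

/-- A planar, single-colored operad in sets. The composition
`γ : X(n) × X(k₁) × ⋯ × X(kₙ) → X(k₁ + ⋯ + kₙ)` takes the arity `m` of its value together with a
proof of `k₁ + ⋯ + kₙ = m`. -/
structure Operad : Type (u + 1) where
  /-- the set of operations of arity `n` -/
  obj : ℕ → Type u
  /-- the identity operation -/
  one : obj 1
  /-- the composition `γ` -/
  comp {n m : ℕ} (k : Fin n → ℕ) (h : ∑ i, k i = m) (x : obj n) (y : ∀ i, obj (k i)) : obj m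
  one_comp {n : ℕ} (h : ∑ _i : Fin 1, n = n) (x : obj n) : comp (fun _ => n) h one (fun _ => x) = x
  comp_one {n : ℕ} (h : ∑ _i : Fin n, 1 = n) (x : obj n) : comp (fun _ => 1) h x (fun _ => one) = x
  assoc {n m M : ℕ} (k : Fin n → ℕ) (h : ∑ i, k i = m) (l : Fin m → ℕ) (hl : ∑ p, l p = M)
    (q : Fin n → ℕ) (hq : ∑ i, q i = M) (hi : ∀ i, ∑ a, l (flat k h ⟨i, a⟩) = q i)
    (x : obj n) (y : ∀ i, obj (k i)) (z : ∀ p, obj (l p)) :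
    comp l hl (comp k h x y) z =
      comp q hq x (fun i => comp (fun a => l (flat k h ⟨i, a⟩)) (hi i) (y i)
        (fun a => z (flat k h ⟨i, a⟩)))

namespace Operad

/-- A map of operads. -/
@[ext]
structure Hom (X Y : Operad.{u}) where
  /-- the map on operations of arity `n` -/
  app (n : ℕ) : X.obj n → Y.obj n
  map_one : app 1 X.one = Y.one
  map_comp {n m : ℕ} (k : Fin n → ℕ) (h : ∑ i, k i = m) (x : X.obj n) (y : ∀ i, X.obj (k i)) :
    app m (X.comp k h x y) = Y.comp k h (app n x) (fun i => app (k i) (y i))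

/-- The category `Op` of operads. -/
instance : Category Operad.{u} where
  Hom := Hom
  id X := ⟨fun _ x => x, rfl, fun _ _ _ _ => rfl⟩
  comp f g := ⟨fun n x => g.app n (f.app n x), by rw [f.map_one, g.map_one],
    fun _ _ _ _ => by rw [f.map_comp, g.map_comp]⟩

@[simp] theorem id_app (X : Operad.{u}) (n : ℕ) (x : X.obj n) : Hom.app (𝟙 X) n x = x := rfl

@[simp] theorem comp_app {X Y Z : Operad.{u}} (f : X ⟶ Y) (g : Y ⟶ Z) (n : ℕ) (x : X.obj n) :
    Hom.app (f ≫ g) n x = g.app n (f.app n x) := rfl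

theorem hom_ext {X Y : Operad.{u}} {f g : X ⟶ Y} (h : ∀ n x, f.app n x = g.app n x) : f = g :=
  Hom.ext (funext fun n => funext fun x => h n x)

theorem hom_congr {X Y : Operad.{u}} {f g : X ⟶ Y} (h : f = g) (n : ℕ) (x : X.obj n) :
    f.app n x = g.app n x := by rw [h]

/-- Substituting equal indices in the arguments of a composition. -/
theorem comp_idx (X : Operad.{u}) {n m : ℕ} {ι : Type*} (l : ι → ℕ) (z : ∀ i, X.obj (l i))
    (x : X.obj n) {f g : Fin n → ι} (hfg : ∀ i, f i = g i) (hf : ∑ i, l (f i) = m)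
    (hg : ∑ i, l (g i) = m) :
    X.comp (fun i => l (f i)) hf x (fun i => z (f i)) =
      X.comp (fun i => l (g i)) hg x (fun i => z (g i)) := by
  obtain rfl : f = g := funext hfg
  rfl

end Operad

/-- The operad `𝔖` of permutation groups. -/
def symOperad : Operad.{u} where
  obj n := ULift.{u} (Equiv.Perm (Fin n))
  one := ⟨1⟩
  comp k h x y := ⟨permComp k h x.down (fun i => (y i).down)⟩
  one_comp h x := congrArg ULift.up (permComp_one_left h x.down)
  comp_one h x := congrArg ULift.up (permComp_one_right h x.down)
  assoc k h l hl q hq hi x y z := congrArg ULift.up (permComp_assoc k h l hl q hq hi _ _ _)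

/-- The trivial operad `∗`. -/
def trivialOperad : Operad.{u} where
  obj _ := PUnit
  one := ⟨⟩
  comp _ _ _ _ := ⟨⟩
  one_comp _ _ := rfl
  comp_one _ _ := rfl
  assoc _ _ _ _ _ _ _ _ _ _ := rfl

/-- The units of the permutation groups, as a map `∗ ⟶ 𝔖` of operads. -/
def symUnit : trivialOperad.{u} ⟶ symOperad.{u} where
  app _ _ := ⟨1⟩
  map_one := rfl
  map_comp k h _ _ := congrArg ULift.up (permComp_one k h).symm

/-- The underlying permutation of an operation, for an operad over `𝔖`. -/
def Operad.perm {Y : Operad.{u}} (ρ : Y ⟶ symOperad) {n : ℕ} (y : Y.obj n) :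
    Equiv.Perm (Fin n) := (ρ.app n y).down

theorem Operad.perm_comp {Y : Operad.{u}} (ρ : Y ⟶ symOperad) {n m : ℕ} (k : Fin n → ℕ)
    (h : ∑ i, k i = m) (x : Y.obj n) (y : ∀ i, Y.obj (k i)) :
    perm ρ (Y.comp k h x y) = permComp k h (perm ρ x) (fun i => perm ρ (y i)) :=
  congrArg ULift.down (ρ.map_comp k h x y)

theorem Operad.perm_one {Y : Operad.{u}} (ρ : Y ⟶ symOperad) : perm ρ Y.one = 1 :=
  congrArg ULift.down ρ.map_one

theorem sum_perm {n m : ℕ} (σ : Equiv.Perm (Fin n)) {k : Fin n → ℕ} (h : ∑ i, k i = m) :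
    ∑ i, k (σ i) = m := (Equiv.sum_comp σ k).trans h

/-- The operad `X ⋊ Y`, for an operad `X` and an operad `ρ : Y ⟶ 𝔖` over `𝔖`. -/
def Operad.semi (X : Operad.{u}) {Y : Operad.{u}} (ρ : Y ⟶ symOperad) : Operad.{u} where
  obj n := X.obj n × Y.obj n
  one := (X.one, Y.one)
  comp k h x y :=
    (X.comp (fun i => k ((perm ρ x.2)⁻¹ i)) (sum_perm _ h) x.1
        (fun i => (y ((perm ρ x.2)⁻¹ i)).1),
      Y.comp k h x.2 (fun i => (y i).2))
  one_comp h x := Prod.ext (X.one_comp h x.1) (Y.one_comp h x.2)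
  comp_one h x := Prod.ext (X.comp_one _ x.1) (Y.comp_one h x.2)
  assoc {n m M} k h l hl q hq hi x y z := by
    refine Prod.ext ?_ (Y.assoc k h l hl q hq hi _ _ _)
    have hp : ∀ (i : Fin n) (a : Fin (k ((perm ρ x.2)⁻¹ i))),
        (perm ρ (Y.comp k h x.2 (fun i => (y i).2)))⁻¹
          (flat (fun i => k ((perm ρ x.2)⁻¹ i)) (sum_perm _ h) ⟨i, a⟩) =
        flat k h ⟨(perm ρ x.2)⁻¹ i, (perm ρ (y ((perm ρ x.2)⁻¹ i)).2)⁻¹ a⟩ := fun i a => by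
      rw [perm_comp]; exact permComp_inv k h _ _ _ i a
    have hs : ∀ i, ∑ a, l (flat k h ⟨(perm ρ x.2)⁻¹ i,
        (perm ρ (y ((perm ρ x.2)⁻¹ i)).2)⁻¹ a⟩) = q ((perm ρ x.2)⁻¹ i) := fun i =>
      sum_perm (k := fun a => l (flat k h ⟨(perm ρ x.2)⁻¹ i, a⟩)) _ (hi _)
    dsimp only
    rw [X.assoc (fun i => k ((perm ρ x.2)⁻¹ i)) _ _ _ (fun i => q ((perm ρ x.2)⁻¹ i))
      (sum_perm _ hq) (fun i => by simp only [hp]; exact hs i)]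
    congr 1
    funext i
    exact X.comp_idx l (fun p => (z p).1) _ (hp i) _ _

/-- Functoriality of `X ⋊ Y`. -/
def Operad.semiMap {X X' Y Y' : Operad.{u}} {ρ : Y ⟶ symOperad} {ρ' : Y' ⟶ symOperad}
    (f : X ⟶ X') (g : Y ⟶ Y') (w : g ≫ ρ' = ρ) : X.semi ρ ⟶ X'.semi ρ' where
  app n x := (f.app n x.1, g.app n x.2)
  map_one := Prod.ext f.map_one g.map_one
  map_comp k h x y := by
    subst w
    exact Prod.ext (f.map_comp _ _ _ _) (g.map_comp _ _ _ _)

/-- The structure map `X ⋊ Y ⟶ 𝔖 ⋊ 𝔖 ⟶ 𝔖`, where the second map is the multiplication. -/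
def Operad.semiHom {X Y : Operad.{u}} (π : X ⟶ symOperad) (ρ : Y ⟶ symOperad) :
    X.semi ρ ⟶ symOperad where
  app n x := ⟨perm π x.1 * perm ρ x.2⟩
  map_one := congrArg ULift.up (by
    change perm π X.one * perm ρ Y.one = 1
    rw [perm_one, perm_one, mul_one])
  map_comp k h x y := congrArg ULift.up (by
    change perm π (X.comp _ _ _ _) * perm ρ (Y.comp _ _ _ _) = permComp _ _ _ _
    rw [perm_comp, perm_comp]
    exact (permComp_mul k h _ _ (fun i => perm π (y i).1) (fun i => perm ρ (y i).2) _).symm)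

namespace OperadOver

/-- The tensor product `⋊` on `Op^{/𝔖}`. -/
def tensor (X Y : Over symOperad.{u}) : Over symOperad.{u} :=
  Over.mk (Operad.semiHom X.hom Y.hom)

/-- The unit object of `Op^{/𝔖}`: the trivial operad with the units of the permutation groups. -/
def unit : Over symOperad.{u} := Over.mk symUnit

theorem over_app {X Y : Over symOperad.{u}} (f : X ⟶ Y) (n : ℕ) (x : X.left.obj n) :
    Y.hom.app n (f.left.app n x) = X.hom.app n x := Operad.hom_congr (Over.w f) n x

theorem over_perm {X Y : Over symOperad.{u}} (f : X ⟶ Y) {n : ℕ} (x : X.left.obj n) :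
    Operad.perm Y.hom (f.left.app n x) = Operad.perm X.hom x := congrArg ULift.down (over_app f n x)

/-- The tensor product `⋊` of maps: `(x, y) ↦ (f x, g y)`. -/
def tensorMap {X X' Y Y' : Over symOperad.{u}} (f : X ⟶ X') (g : Y ⟶ Y') :
    tensor X Y ⟶ tensor X' Y' :=
  Over.homMk (Operad.semiMap f.left g.left (Over.w g)) (Operad.hom_ext fun n x =>
    congrArg ULift.up (congrArg₂ (· * ·) (over_perm f x.1) (over_perm g x.2)))

/-- An isomorphism in `Op^{/𝔖}` from a bijective map. -/
def isoOfEquiv {X Y : Over symOperad.{u}} (f : X ⟶ Y) (g : ∀ n, Y.left.obj n → X.left.obj n)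
    (hfg : ∀ n x, g n (f.left.app n x) = x) (hgf : ∀ n y, f.left.app n (g n y) = y) : X ≅ Y where
  hom := f
  inv := Over.homMk
    { app := g
      map_one := by rw [← f.left.map_one, hfg]
      map_comp := fun k h x y => by
        rw [← hfg _ (X.left.comp _ _ _ _), f.left.map_comp]
        simp only [hgf] }
    (Operad.hom_ext fun n y => by
      change X.hom.app n (g n y) = _
      rw [← over_app f, hgf])
  hom_inv_id := Over.OverMorphism.ext (Operad.hom_ext hfg)
  inv_hom_id := Over.OverMorphism.ext (Operad.hom_ext hgf)

/-- The associativity `((x, y), z) ↦ (x, (y, z))`. -/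
def assoc (X Y Z : Over symOperad.{u}) : tensor (tensor X Y) Z ≅ tensor X (tensor Y Z) :=
  isoOfEquiv (Over.homMk
      { app := fun _ x => (x.1.1, x.1.2, x.2)
        map_one := rfl
        map_comp := fun k h x y => rfl }
      (Operad.hom_ext fun n x => congrArg ULift.up (mul_assoc _ _ _).symm))
    (fun _ x => ((x.1, x.2.1), x.2.2)) (fun _ _ => rfl) (fun _ _ => rfl)

/-- The left unit isomorphism `(∗, x) ↦ x`. -/
def leftUnit (X : Over symOperad.{u}) : tensor unit X ≅ X :=
  isoOfEquiv (Over.homMk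
      { app := fun _ x => x.2
        map_one := rfl
        map_comp := fun k h x y => rfl }
      (Operad.hom_ext fun n x => congrArg ULift.up (one_mul _).symm))
    (fun _ x => (⟨⟩, x)) (fun _ _ => rfl) (fun _ _ => rfl)

/-- The right unit isomorphism `(x, ∗) ↦ x`. -/
def rightUnit (X : Over symOperad.{u}) : tensor X unit ≅ X :=
  isoOfEquiv (Over.homMk
      { app := fun _ x => x.1
        map_one := rfl
        map_comp := fun k h x y => rfl }
      (Operad.hom_ext fun n x => congrArg ULift.up (mul_one _).symm))
    (fun _ x => (x, ⟨⟩)) (fun _ _ => rfl) (fun _ _ => rfl)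

/-- The monoidal structure `⋊` on `Op^{/𝔖}`. -/
instance : MonoidalCategory (Over symOperad.{u}) where
  tensorObj := tensor
  whiskerLeft X _ _ f := tensorMap (𝟙 X) f
  whiskerRight f Y := tensorMap f (𝟙 Y)
  tensorHom := tensorMap
  tensorUnit := unit
  associator := assoc
  leftUnitor := leftUnit
  rightUnitor := rightUnit
  tensorHom_def _ _ := rfl
  id_tensorHom_id _ _ := rfl
  tensorHom_comp_tensorHom _ _ _ _ := rfl
  whiskerLeft_id _ _ := rfl
  id_whiskerRight _ _ := rfl
  associator_naturality _ _ _ := rfl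
  leftUnitor_naturality _ := rfl
  rightUnitor_naturality _ := rfl
  pentagon _ _ _ _ := rfl
  triangle _ _ := rfl

end OperadOver

/-- The category `MonOp` of monoid operads: monoid objects in `(Op^{/𝔖}, ⋊)`. -/
abbrev MonOp : Type (u + 1) := Mon (Over symOperad.{u})

/-! ### Ternary compositions and base points -/

namespace Operad

theorem comp_ext (X : Operad.{u}) {n m : ℕ} {k k' : Fin n → ℕ} (hk : ∀ i, k i = k' i)
    (h : ∑ i, k i = m) (h' : ∑ i, k' i = m) (x : X.obj n) {y : ∀ i, X.obj (k i)}
    {y' : ∀ i, X.obj (k' i)} (hy : ∀ i, y i ≍ y' i) : X.comp k h x y = X.comp k' h' x y' := by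
  obtain rfl : k = k' := funext hk
  obtain rfl : y = y' := funext fun i => eq_of_heq (hy i)
  rfl

theorem flat₃_zero {a b c m : ℕ} (h : ∑ i, ![a, b, c] i = m) (x : Fin a) :
    (flat ![a, b, c] h ⟨0, x⟩ : ℕ) = x :=
  (flat_val ![a, b, c] h 0 x).trans (by simp)

theorem flat₃_one {a b c m : ℕ} (h : ∑ i, ![a, b, c] i = m) (x : Fin b) :
    (flat ![a, b, c] h ⟨1, x⟩ : ℕ) = a + x :=
  (flat_val ![a, b, c] h 1 x).trans (by simp)

theorem flat₃_two {a b c m : ℕ} (h : ∑ i, ![a, b, c] i = m) (x : Fin c) :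
    (flat ![a, b, c] h ⟨2, x⟩ : ℕ) = a + b + x :=
  (flat_val ![a, b, c] h 2 x).trans (by simp [Fin.sum_univ_three])

/-- The ternary composition `γ(t; x, y, z)`. -/
def comp₃ (X : Operad.{u}) {a b c m : ℕ} (h : a + b + c = m) (t : X.obj 3) (x : X.obj a)
    (y : X.obj b) (z : X.obj c) : X.obj m :=
  X.comp ![a, b, c] (by simp [Fin.sum_univ_three, h]) t
    (fun | 0 => x | 1 => y | 2 => z)

theorem hom_comp₃ {X Y : Operad.{u}} (f : X ⟶ Y) {a b c m : ℕ} (h : a + b + c = m) (t : X.obj 3)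
    (x : X.obj a) (y : X.obj b) (z : X.obj c) :
    f.app m (X.comp₃ h t x y z) =
      Y.comp₃ h (f.app 3 t) (f.app a x) (f.app b y) (f.app c z) := by
  refine (f.map_comp _ _ _ _).trans (comp_ext _ (fun _ => rfl) _ _ _ ?_)
  intro i; fin_cases i <;> rfl

end Operad

/-- The element `1 ≤ i ≤ n` of `⟪n⟫ = {-∞, 1, …, n, ∞}`. -/
def mid {n : ℕ} (i : Fin n) : Fin (n + 2) := i.castSucc.succ

theorem mid_val {n : ℕ} (i : Fin n) : (mid i : ℕ) = i + 1 := rfl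

theorem mid_ne_zero {n : ℕ} (i : Fin n) : mid i ≠ 0 := by simp [Fin.ext_iff, mid_val]

theorem mid_ne_last {n : ℕ} (i : Fin n) : mid i ≠ Fin.last (n + 1) := by
  simp [Fin.ext_iff, mid_val]; omega

theorem mid_inj {n : ℕ} {i j : Fin n} : mid i = mid j ↔ i = j := by
  simp [Fin.ext_iff, mid_val]

theorem eq_mid {n : ℕ} (j : Fin (n + 2)) : j = 0 ∨ j = Fin.last (n + 1) ∨ ∃ i, j = mid i := by
  by_cases h0 : (j : ℕ) = 0
  · exact Or.inl (Fin.ext h0)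
  by_cases h1 : (j : ℕ) = n + 1
  · exact Or.inr (Or.inl (Fin.ext h1))
  · exact Or.inr (Or.inr ⟨⟨j - 1, by omega⟩, Fin.ext (by rw [mid_val]; simp; omega)⟩)

theorem sum_mid {n : ℕ} {M : Type*} [AddCommMonoid M] (f : Fin (n + 2) → M) :
    ∑ j, f j = f 0 + ∑ i : Fin n, f (mid i) + f (Fin.last (n + 1)) := by
  rw [Fin.sum_univ_succ, Fin.sum_univ_castSucc, ← add_assoc]; rfl

namespace Operad

variable (X : Operad.{u})

/-- `γ(t; 1, x, 1)`. -/
def hat (t : X.obj 3) {n : ℕ} (x : X.obj n) : X.obj (n + 2) :=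
  X.comp₃ (by omega) t X.one x X.one

theorem comp_hat (t : X.obj 3) {n m : ℕ} (x : X.obj n) (κ : Fin (n + 2) → ℕ) (h : ∑ j, κ j = m)
    (c : ∀ j, X.obj (κ j)) {s : ℕ} (hs : ∑ i, κ (mid i) = s)
    (hm : κ 0 + s + κ (Fin.last (n + 1)) = m) :
    X.comp κ h (X.hat t x) c =
      X.comp₃ hm t (c 0) (X.comp (fun i => κ (mid i)) hs x (fun i => c (mid i)))
        (c (Fin.last (n + 1))) := by
  have hk : ∑ i, ![1, n, 1] i = n + 2 := by simp [Fin.sum_univ_three]; omega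
  have f0 : ∀ a : Fin 1, flat ![1, n, 1] hk ⟨0, a⟩ = 0 := fun a =>
      Fin.ext ((flat₃_zero _ a).trans (by simp))
  have f1 : ∀ a : Fin n, flat ![1, n, 1] hk ⟨1, a⟩ = mid a := fun a =>
      Fin.ext ((flat₃_one _ a).trans (by simp [mid_val]; omega))
  have f2 : ∀ a : Fin 1, flat ![1, n, 1] hk ⟨2, a⟩ = Fin.last (n + 1) := fun a =>
      Fin.ext ((flat₃_two _ a).trans (by simp; omega))
  have g0 : ∑ a : Fin 1, κ (flat ![1, n, 1] hk ⟨0, a⟩) = κ 0 := by simp only [f0]; simp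
  have g1 : ∑ a : Fin n, κ (flat ![1, n, 1] hk ⟨1, a⟩) = s := by simp only [f1]; exact hs
  have g2 : ∑ a : Fin 1, κ (flat ![1, n, 1] hk ⟨2, a⟩) = κ (Fin.last (n + 1)) := by
    simp only [f2]; simp
  unfold hat comp₃
  rw [X.assoc _ _ κ h ![κ 0, s, κ (Fin.last (n + 1))] (by simp [Fin.sum_univ_three, hm])
    (by intro i; fin_cases i; exacts [g0, g1, g2])]
  refine congrArg _ (funext fun i => ?_)
  fin_cases i
  · exact (X.comp_idx κ c _ (g := fun _ => 0) f0 g0 (by simp)).trans (X.one_comp _ _)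
  · exact X.comp_idx κ c _ f1 g1 hs
  · exact (X.comp_idx κ c _ (g := fun _ => Fin.last (n + 1)) f2 g2 (by simp)).trans
      (X.one_comp _ _)

variable {X}

/-- The base point in arity `n` of a pointed operad. -/
def pt (e : trivialOperad ⟶ X) (n : ℕ) : X.obj n := e.app n ⟨⟩

theorem pt_one (e : trivialOperad ⟶ X) : pt e 1 = X.one := e.map_one

theorem comp_pt (e : trivialOperad ⟶ X) {n m : ℕ} (k : Fin n → ℕ) (h : ∑ i, k i = m) :
    X.comp k h (pt e n) (fun i => pt e (k i)) = pt e m :=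
  (e.map_comp k h ⟨⟩ (fun _ => ⟨⟩)).symm

theorem pt_congr (e : trivialOperad ⟶ X) {n m : ℕ} (h : n = m) : pt e n ≍ pt e m := by rw [h]

theorem comp_pt' (e : trivialOperad ⟶ X) {n m : ℕ} (k : Fin n → ℕ) (h : ∑ i, k i = m)
    (y : ∀ i, X.obj (k i)) (hy : ∀ i, y i = pt e (k i)) : X.comp k h (pt e n) y = pt e m := by
  obtain rfl : y = fun i => pt e (k i) := funext hy
  exact comp_pt e k h

theorem comp₃_pt_zero (e : trivialOperad ⟶ X) {n : ℕ} (h : 0 + n + 0 = n) (x : X.obj n) :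
    X.comp₃ h (pt e 3) (pt e 0) x (pt e 0) = x := by
  have hk : ∑ i, ![0, 1, 0] i = 1 := by simp [Fin.sum_univ_three]
  have h1 : X.comp ![0, 1, 0] hk (pt e 3) (fun i => pt e (![0, 1, 0] i)) = X.one := by
    rw [comp_pt, pt_one]
  refine Eq.trans ?_ (X.one_comp (by simp) x)
  rw [← h1, X.assoc _ hk (fun _ => n) (by simp) ![0, n, 0] (by simp [Fin.sum_univ_three])
    (by intro i; fin_cases i; exacts [Fin.sum_univ_zero _, Fin.sum_univ_one _, Fin.sum_univ_zero _])]
  unfold comp₃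
  refine congrArg _ (funext fun i => ?_)
  fin_cases i
  · exact (comp_pt' e _ _ _ (fun i => Fin.elim0 i)).symm
  · exact ((congrArg (fun y => X.comp (fun _ => n) (by simp) y fun _ => x) (pt_one e)).trans
      (X.one_comp _ x)).symm
  · exact (comp_pt' e _ _ _ (fun i => Fin.elim0 i)).symm

theorem hat_injective (e : trivialOperad ⟶ X) {n : ℕ} {x x' : X.obj n}
    (h : X.hat (pt e 3) x = X.hat (pt e 3) x') : x = x' := by
  let κ : Fin (n + 2) → ℕ := fun j => if j = 0 ∨ j = Fin.last (n + 1) then 0 else 1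
  have k0 : κ 0 = 0 := by simp [κ]
  have kl : κ (Fin.last (n + 1)) = 0 := by simp [κ]
  have km : ∀ i, κ (mid i) = 1 := fun i => by simp [κ, mid_ne_zero, mid_ne_last]
  have hs : ∑ i : Fin n, κ (mid i) = n := by simp [km]
  have hm : κ 0 + n + κ (Fin.last (n + 1)) = n := by rw [k0, kl]; omega
  have hκ : ∑ j, κ j = n := by rw [sum_mid, hs, hm]
  have key : ∀ x : X.obj n, X.comp κ hκ (X.hat (pt e 3) x) (fun j => pt e (κ j)) = x := fun x => by
    rw [X.comp_hat _ _ _ _ _ hs hm]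
    have : X.comp (fun i => κ (mid i)) hs x (fun i => pt e (κ (mid i))) = x := by
      refine (X.comp_ext km _ (by simp) x fun i => (pt_congr e (km i)).trans ?_).trans
        (X.comp_one (by simp) x)
      exact heq_of_eq (pt_one e)
    rw [this]
    refine Eq.trans ?_ (comp₃_pt_zero e (by omega) x)
    refine X.comp_ext ?_ _ _ _ ?_
    · intro i; fin_cases i; exacts [k0, rfl, kl]
    · intro i; fin_cases i; exacts [pt_congr e k0, HEq.rfl, pt_congr e kl]
  rw [← key x, h, key]

theorem hat_comp₃ (e : trivialOperad ⟶ X) {a b c m : ℕ} (h : a + b + c = m) (y : X.obj b)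
    (h' : a + 1 + b + (c + 1) = m + 2) :
    X.hat (pt e 3) (X.comp₃ h (pt e 3) (pt e a) y (pt e c)) =
      X.comp₃ h' (pt e 3) (pt e (a + 1)) y (pt e (c + 1)) := by
  let l : Fin 5 → ℕ := ![1, a, b, c, 1]
  let z : ∀ p, X.obj (l p) :=
    fun | 0 => X.one | 1 => pt e a | 2 => y | 3 => pt e c | 4 => X.one
  have hl : ∑ p, l p = m + 2 := by simp [l, Fin.sum_univ_five]; omega
  have h131 : ∑ i, ![1, 3, 1] i = 5 := by simp [Fin.sum_univ_three]
  have h212 : ∑ i, ![2, 1, 2] i = 5 := by simp [Fin.sum_univ_three]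
  trans X.comp l hl (pt e 5) z
  · rw [← comp_pt e ![1, 3, 1] h131]
    have f0 : ∀ a : Fin 1, flat ![1, 3, 1] h131 ⟨0, a⟩ = 0 := fun a =>
      Fin.ext ((flat₃_zero _ a).trans (by simp))
    have f1 : ∀ a : Fin 3, flat ![1, 3, 1] h131 ⟨1, a⟩ = ![1, 2, 3] a := fun a =>
      Fin.ext ((flat₃_one _ a).trans (by fin_cases a <;> rfl))
    have f2 : ∀ a : Fin 1, flat ![1, 3, 1] h131 ⟨2, a⟩ = 4 := fun a =>
      Fin.ext ((flat₃_two _ a).trans (by simp))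
    have g0 : ∑ a : Fin 1, l (flat ![1, 3, 1] h131 ⟨0, a⟩) = 1 := by simp only [f0]; simp [l]
    have g1 : ∑ a : Fin 3, l (flat ![1, 3, 1] h131 ⟨1, a⟩) = m := by
      simp only [f1]; simp [l, Fin.sum_univ_three, h]
    have g2 : ∑ a : Fin 1, l (flat ![1, 3, 1] h131 ⟨2, a⟩) = 1 := by simp only [f2]; simp [l]
    rw [X.assoc _ _ l hl ![1, m, 1] (by simp [Fin.sum_univ_three]; omega)
      (by intro i; fin_cases i; exacts [g0, g1, g2])]
    unfold hat comp₃
    refine congrArg _ (funext fun i => ?_)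
    fin_cases i
    · refine (((X.comp_idx l z _ (g := fun _ => 0) f0 g0 (by simp [l]))).trans ?_).symm
      exact comp_pt' e (fun _ => 1) _ _ (fun _ => (pt_one e).symm) |>.trans (pt_one e)
    · refine (((X.comp_idx l z _ (g := ![1, 2, 3]) f1 g1
        (by simp [l, Fin.sum_univ_three, h]))).trans ?_).symm
      refine X.comp_ext ?_ _ _ _ ?_
      · intro i; fin_cases i <;> rfl
      · intro i; fin_cases i <;> rfl
    · refine (((X.comp_idx l z _ (g := fun _ => 4) f2 g2 (by simp [l]))).trans ?_).symm
      exact comp_pt' e (fun _ => 1) _ _ (fun _ => (pt_one e).symm) |>.trans (pt_one e)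
  · rw [← comp_pt e ![2, 1, 2] h212]
    have f0 : ∀ a : Fin 2, flat ![2, 1, 2] h212 ⟨0, a⟩ = ![0, 1] a := fun a =>
      Fin.ext ((flat₃_zero _ a).trans (by fin_cases a <;> rfl))
    have f1 : ∀ a : Fin 1, flat ![2, 1, 2] h212 ⟨1, a⟩ = 2 := fun a =>
      Fin.ext ((flat₃_one _ a).trans (by simp))
    have f2 : ∀ a : Fin 2, flat ![2, 1, 2] h212 ⟨2, a⟩ = ![3, 4] a := fun a =>
      Fin.ext ((flat₃_two _ a).trans (by fin_cases a <;> rfl))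
    have g0 : ∑ i : Fin 2, l (flat ![2, 1, 2] h212 ⟨0, i⟩) = a + 1 := by
      simp only [f0]; simp [l]; omega
    have g1 : ∑ i : Fin 1, l (flat ![2, 1, 2] h212 ⟨1, i⟩) = b := by simp only [f1]; simp [l]
    have g2 : ∑ i : Fin 2, l (flat ![2, 1, 2] h212 ⟨2, i⟩) = c + 1 := by
      simp only [f2]; simp [l]
    rw [X.assoc _ _ l hl ![a + 1, b, c + 1] (by simp [Fin.sum_univ_three]; omega)
      (by intro i; fin_cases i; exacts [g0, g1, g2])]
    unfold comp₃
    refine congrArg _ (funext fun i => ?_)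
    fin_cases i
    · refine ((X.comp_idx l z _ (g := ![0, 1]) f0 g0 (by simp [l]; omega))).trans ?_
      refine comp_pt' e _ _ _ fun i => ?_
      fin_cases i
      exacts [(pt_one e).symm, rfl]
    · refine ((X.comp_idx l z _ (g := fun _ => 2) f1 g1 (by simp [l]))).trans ?_
      exact (congrArg (fun w => X.comp (fun _ => b) (by simp) w fun _ => y) (pt_one e)).trans
        (X.one_comp _ y)
    · refine ((X.comp_idx l z _ (g := ![3, 4]) f2 g2 (by simp [l]))).trans ?_
      refine comp_pt' e _ _ _ fun i => ?_
      fin_cases i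
      exacts [rfl, (pt_one e).symm]

end Operad

/-! ### The category of intervals -/

/-- Objects of the category `∇` of intervals: `⟨n⟩` stands for the linearly ordered set
`⟪n⟫ = {-∞, 1, …, n, ∞}`, which is modelled by `Fin (n + 2)`, with `-∞ = 0`, `∞ = Fin.last (n + 1)`
and with `mid i` for the other elements. -/
structure Nabla where
  /-- the number of elements other than `±∞` -/
  n : ℕ

namespace Nabla

/-- Morphisms of `∇`: order-preserving maps that preserve `-∞` and `∞`. -/
@[ext]
structure Hom (a b : Nabla) where
  /-- the underlying map -/
  toFun : Fin (a.n + 2) → Fin (b.n + 2)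
  monotone : Monotone toFun
  map_bot : toFun 0 = 0
  map_top : toFun (Fin.last (a.n + 1)) = Fin.last (b.n + 1)

instance : SmallCategory Nabla where
  Hom := Hom
  id a := ⟨id, monotone_id, rfl, rfl⟩
  comp f g := ⟨g.toFun ∘ f.toFun, g.monotone.comp f.monotone, by simp [f.map_bot, g.map_bot],
    by simp [f.map_top, g.map_top]⟩

/-- The number of elements of the fibre of `φ` over `j`. -/
def Hom.card {a b : Nabla} (φ : Hom a b) (j : Fin (b.n + 2)) : ℕ :=
  (Finset.univ.filter fun i => φ.toFun i = j).card

/-- The number `k_j` attached to `φ`: the number of elements of the fibre over `j` other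
than `±∞`. -/
def Hom.k {a b : Nabla} (φ : Hom a b) (j : Fin (b.n + 2)) : ℕ :=
  if j = 0 ∨ j = Fin.last (b.n + 1) then φ.card j - 1 else φ.card j

namespace Hom

variable {a b c : Nabla}

theorem k_zero (φ : Hom a b) : φ.k 0 = φ.card 0 - 1 := by simp [k]

theorem k_last (φ : Hom a b) :
    φ.k (Fin.last (b.n + 1)) = φ.card (Fin.last (b.n + 1)) - 1 := by simp [k]

theorem k_mid (φ : Hom a b) (i : Fin b.n) : φ.k (mid i) = φ.card (mid i) := by
  simp [k, mid_ne_zero, mid_ne_last]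

theorem sum_card (φ : Hom a b) : ∑ j, φ.card j = a.n + 2 := by
  have := Finset.card_eq_sum_card_fiberwise (f := φ.toFun) (s := Finset.univ) (t := Finset.univ)
    (fun _ _ => Finset.mem_coe.2 (Finset.mem_univ _))
  simpa [card] using this.symm

theorem card_zero_pos (φ : Hom a b) : 0 < φ.card 0 :=
  Finset.card_pos.2 ⟨0, by simp [φ.map_bot]⟩

theorem card_last_pos (φ : Hom a b) : 0 < φ.card (Fin.last (b.n + 1)) :=
  Finset.card_pos.2 ⟨Fin.last _, by simp [φ.map_top]⟩

theorem k_zero_add (φ : Hom a b) : φ.k 0 + 1 = φ.card 0 := by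
  rw [k_zero]; have := φ.card_zero_pos; omega

theorem k_last_add (φ : Hom a b) :
    φ.k (Fin.last (b.n + 1)) + 1 = φ.card (Fin.last (b.n + 1)) := by
  rw [k_last]; have := φ.card_last_pos; omega

theorem sum_k (φ : Hom a b) : φ.k 0 + ∑ i, φ.k (mid i) + φ.k (Fin.last (b.n + 1)) = a.n := by
  have h := φ.sum_card
  rw [sum_mid, ← k_zero_add, ← k_last_add] at h
  simp only [← k_mid] at h
  omega

theorem lower_card {m : ℕ} (p : Fin m → Prop) [DecidablePred p] (hp : ∀ i j, i ≤ j → p j → p i)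
    (i : Fin m) : p i ↔ (i : ℕ) < (Finset.univ.filter p).card := by
  constructor
  · intro h
    have : Finset.Iic i ⊆ Finset.univ.filter p := fun j hj => by
      simpa using hp j i (by simpa using hj) h
    have := Finset.card_le_card this
    rw [Fin.card_Iic] at this
    omega
  · intro h
    by_contra hi
    have : Finset.univ.filter p ⊆ Finset.Iio i := fun j hj => by
      rw [Finset.mem_Iio]
      by_contra hij
      exact hi (hp i j (not_lt.1 hij) (by simpa using hj))
    have := Finset.card_le_card this
    rw [Fin.card_Iio] at this
    omega

/-- The fibres of `φ` are the consecutive blocks. -/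
theorem apply_flat (φ : Hom a b) (j : Fin (b.n + 2)) (x : Fin (φ.card j)) :
    φ.toFun (flat φ.card φ.sum_card ⟨j, x⟩) = j := by
  have hc : ∀ (p : Fin (b.n + 2) → Prop) [DecidablePred p],
      (Finset.univ.filter fun i => p (φ.toFun i)).card = ∑ l, if p l then φ.card l else 0 := by
    intro p _
    rw [← Finset.sum_filter]
    rw [Finset.card_eq_sum_card_fiberwise (f := φ.toFun) (t := Finset.univ.filter p)
      (fun _ hi => by simpa using hi)]
    refine Finset.sum_congr rfl fun l hl => ?_
    congr 1
    ext i
    simp only [Finset.mem_filter, Finset.mem_univ, true_and] at hl ⊢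
    exact ⟨fun h => h.2, fun h => ⟨h ▸ hl, h⟩⟩
  have hx := x.2
  have hv := flat_val φ.card φ.sum_card j x
  have h1 := lower_card (fun i => φ.toFun i < j) (fun i i' h h' => (φ.monotone h).trans_lt h')
    (flat φ.card φ.sum_card ⟨j, x⟩)
  have h2 := lower_card (fun i => φ.toFun i ≤ j) (fun i i' h h' => (φ.monotone h).trans h')
    (flat φ.card φ.sum_card ⟨j, x⟩)
  rw [hc (· < j), hv] at h1
  rw [hc (· ≤ j), hv] at h2
  have h3 : ∑ l, (if l ≤ j then φ.card l else 0) =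
      ∑ l, (if l < j then φ.card l else 0) + φ.card j := by
    have : φ.card j = ∑ l, (if l = j then φ.card l else 0) := by simp
    rw [this, ← Finset.sum_add_distrib]
    refine Finset.sum_congr rfl fun l _ => ?_
    rcases lt_trichotomy l j with h | rfl | h
    · simp [h.le, h, h.ne]
    · simp
    · simp [h.not_ge, h.not_gt, h.ne']
  refine le_antisymm (h2.2 (by omega)) (not_lt.1 fun h => ?_)
  have := h1.1 h
  omega

/-- A morphism of `∇` is determined by the sizes of its fibres. -/
theorem ext_card {φ ψ : Hom a b} (h : ∀ j, φ.card j = ψ.card j) : φ = ψ := by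
  ext p : 2
  obtain ⟨⟨j, x⟩, rfl⟩ := (flat φ.card φ.sum_card).surjective p
  rw [φ.apply_flat, flat_congr (funext h) φ.sum_card ψ.sum_card, ψ.apply_flat]

theorem card_comp (ψ : a ⟶ b) (φ : b ⟶ c) (j : Fin (c.n + 2)) :
    ∑ x, card ψ (flat φ.card φ.sum_card ⟨j, x⟩) = Hom.card (ψ ≫ φ) j := by
  have h1 : ∀ l (x : Fin (φ.card l)), φ.toFun (flat φ.card φ.sum_card ⟨l, x⟩) = l := φ.apply_flat
  have h2 : Hom.card (ψ ≫ φ) j = ∑ p, if φ.toFun p = j then ψ.card p else 0 := by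
    unfold card
    rw [← Finset.sum_filter,
      Finset.card_eq_sum_card_fiberwise (f := ψ.toFun)
        (t := Finset.univ.filter fun p => φ.toFun p = j)
        (fun i hi => by simpa using! hi)]
    refine Finset.sum_congr rfl fun l hl => ?_
    congr 1
    ext i
    simp only [Finset.mem_filter, Finset.mem_univ, true_and] at hl ⊢
    exact ⟨fun h => h.2, fun h => ⟨by rw [← hl, ← h]; rfl, h⟩⟩
  rw [h2, ← flat_sum φ.card φ.sum_card]
  simp only [h1]
  rw [Finset.sum_eq_single j (fun l _ hl => by simp [hl]) (by simp)]
  simp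

/-- The morphism of `∇` with fibres of given sizes. -/
def ofCard (a b : Nabla) (κ : Fin (b.n + 2) → ℕ) (h : ∑ j, κ j = a.n + 2) (h0 : 0 < κ 0)
    (h1 : 0 < κ (Fin.last (b.n + 1))) : Hom a b where
  toFun p := ((flat κ h).symm p).1
  monotone p q hpq := by
    obtain ⟨⟨i, x⟩, rfl⟩ := (flat κ h).surjective p
    obtain ⟨⟨j, y⟩, rfl⟩ := (flat κ h).surjective q
    simp only [Equiv.symm_apply_apply]
    by_contra hij
    exact hpq.not_gt (flat_lt_of_lt κ h (not_le.1 hij) y x)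
  map_bot := by
    have : (0 : Fin (a.n + 2)) = flat κ h ⟨0, ⟨0, h0⟩⟩ := Fin.ext (by rw [flat_val]; simp)
    rw [this, Equiv.symm_apply_apply]
  map_top := by
    have : Fin.last (a.n + 1) = flat κ h ⟨Fin.last (b.n + 1),
        ⟨κ (Fin.last (b.n + 1)) - 1, by omega⟩⟩ := by
      obtain ⟨⟨j, y⟩, hj⟩ := (flat κ h).surjective (Fin.last (a.n + 1))
      refine le_antisymm ?_ (Fin.le_last _)
      rw [← hj]
      refine not_lt.1 fun hlt => ?_
      rcases (flat_lt_iff κ h _ _ _ _).1 hlt with h2 | ⟨h2, h3⟩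
      · exact absurd h2 (Fin.le_last j).not_gt
      · subst h2
        have := y.2
        simp only at h3
        omega
    rw [this, Equiv.symm_apply_apply]

theorem card_ofCard (κ : Fin (b.n + 2) → ℕ) (h : ∑ j, κ j = a.n + 2) (h0 : 0 < κ 0)
    (h1 : 0 < κ (Fin.last (b.n + 1))) (j : Fin (b.n + 2)) :
    (ofCard a b κ h h0 h1).card j = κ j := by
  unfold card ofCard
  have : (Finset.univ.filter fun i => ((flat κ h).symm i).1 = j) =
      (Finset.univ : Finset (Fin (κ j))).map
        ⟨fun x => flat κ h ⟨j, x⟩, fun x y hxy => by simpa using hxy⟩ := by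
    ext p
    obtain ⟨⟨i, x⟩, rfl⟩ := (flat κ h).surjective p
    simp only [Finset.mem_filter, Finset.mem_univ, true_and, Equiv.symm_apply_apply,
      Finset.mem_map]
    constructor
    · rintro rfl; exact ⟨x, rfl⟩
    · rintro ⟨y, hy⟩; exact (congrArg Sigma.fst ((flat κ h).injective hy)).symm
  rw [this, Finset.card_map, Finset.card_univ, Fintype.card_fin]

theorem card_id (a : Nabla) (j : Fin (a.n + 2)) : Hom.card (𝟙 a) j = 1 := by
  unfold card
  rw [Finset.card_eq_one]
  exact ⟨j, by ext i; simp only [Finset.mem_filter, Finset.mem_univ, true_and,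
    Finset.mem_singleton]; rfl⟩

end Hom

end Nabla

/-- The category `Set_∇` of interval sets: presheaves on `∇`. -/
abbrev IntervalSet : Type (u + 1) := Nablaᵒᵖ ⥤ Type u

namespace Operad

variable {X : Operad.{u}}

/-- The element `γ(e₃; e_{k_{-∞}}, γ(x; c₁, …, cₙ), e_{k_∞})` for a morphism `φ` of `∇` with numbers
`k_j`, and for `c_i ∈ X(k_i)`. -/
def pull (e : trivialOperad ⟶ X) {a b : Nabla} (φ : a ⟶ b) (x : X.obj b.n)
    (c : ∀ i : Fin b.n, X.obj (φ.k (mid i))) : X.obj a.n :=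
  X.comp₃ φ.sum_k (pt e 3) (pt e (φ.k 0)) (X.comp (fun i => φ.k (mid i)) rfl x c)
    (pt e (φ.k (Fin.last (b.n + 1))))

theorem hat_pull (e : trivialOperad ⟶ X) {a b : Nabla} (φ : a ⟶ b) (x : X.obj b.n)
    (c : ∀ i : Fin b.n, X.obj (φ.k (mid i))) (C : ∀ j, X.obj (φ.card j))
    (h0 : C 0 = pt e _) (h1 : C (Fin.last (b.n + 1)) = pt e _) (hc : ∀ i, c i ≍ C (mid i)) :
    X.hat (pt e 3) (pull e φ x c) = X.comp φ.card φ.sum_card (X.hat (pt e 3) x) C := by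
  have hs : ∑ i, φ.card (mid i) = ∑ i, φ.k (mid i) := by simp only [φ.k_mid]
  have hm : φ.card 0 + ∑ i, φ.k (mid i) + φ.card (Fin.last (b.n + 1)) = a.n + 2 := by
    rw [← φ.k_zero_add, ← φ.k_last_add]
    have := φ.sum_k
    omega
  rw [X.comp_hat _ _ _ _ _ hs hm]
  unfold pull
  rw [hat_comp₃ e _ _ (by have := φ.sum_k; omega), h0, h1,
    X.comp_ext (fun i => φ.k_mid i) rfl hs x hc]
  refine X.comp_ext ?_ _ _ _ ?_
  · intro i; fin_cases i; exacts [φ.k_zero_add, rfl, φ.k_last_add]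
  · intro i; fin_cases i; exacts [pt_congr e φ.k_zero_add, HEq.rfl, pt_congr e φ.k_last_add]

/-- The map `φ^* : Ψ(X)ₙ → Ψ(X)ₘ`,
`x ↦ γ(e₃; e_{k_{-∞}}, γ(x; e_{k_1}, …, e_{k_n}), e_{k_∞})`. -/
def psiMap (e : trivialOperad ⟶ X) {a b : Nabla} (φ : a ⟶ b) (x : X.obj b.n) : X.obj a.n :=
  pull e φ x fun i => pt e (φ.k (mid i))

theorem hat_psiMap (e : trivialOperad ⟶ X) {a b : Nabla} (φ : a ⟶ b) (x : X.obj b.n) :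
    X.hat (pt e 3) (psiMap e φ x) =
      X.comp φ.card φ.sum_card (X.hat (pt e 3) x) (fun j => pt e (φ.card j)) :=
  hat_pull e φ x _ _ rfl rfl fun i => pt_congr e (φ.k_mid i)

theorem psiMap_id (e : trivialOperad ⟶ X) {a : Nabla} (x : X.obj a.n) : psiMap e (𝟙 a) x = x := by
  refine hat_injective e ((hat_psiMap e _ x).trans ?_)
  refine (X.comp_ext (Nabla.Hom.card_id a) _ (by simp) _ fun i => ?_).trans (X.comp_one _ _)
  exact (pt_congr e (Nabla.Hom.card_id a i)).trans (heq_of_eq (pt_one e))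

theorem psiMap_comp (e : trivialOperad ⟶ X) {a b c : Nabla} (ψ : a ⟶ b) (φ : b ⟶ c)
    (x : X.obj c.n) : psiMap e (ψ ≫ φ) x = psiMap e ψ (psiMap e φ x) := by
  refine hat_injective e ?_
  rw [hat_psiMap, hat_psiMap, hat_psiMap, X.assoc _ _ _ _ (Nabla.Hom.card (ψ ≫ φ))
    (Nabla.Hom.sum_card _) (Nabla.Hom.card_comp ψ φ)]
  exact congrArg _ (funext fun j => (comp_pt e _ _).symm)

theorem map_psiMap {Y : Operad.{u}} (f : X ⟶ Y) (e : trivialOperad ⟶ X) {a b : Nabla}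
    (φ : a ⟶ b) (x : X.obj b.n) :
    f.app a.n (psiMap e φ x) = psiMap (e ≫ f) φ (f.app b.n x) := by
  unfold psiMap pull
  rw [hom_comp₃, f.map_comp]
  rfl

end Operad

/-! ### The functor `Ψ` -/

/-- The functor `Ψ : Op^{∗/} ⥤ Set_∇` from pointed operads to interval sets. -/
def psi : Under trivialOperad.{u} ⥤ IntervalSet.{u} where
  obj X :=
    { obj := fun a => X.right.obj a.unop.n
      map := fun φ => TypeCat.ofHom (Operad.psiMap X.hom φ.unop)
      map_id := fun _ => by ext x; exact Operad.psiMap_id X.hom x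
      map_comp := fun φ ψ => by ext x; exact Operad.psiMap_comp X.hom ψ.unop φ.unop x }
  map {X Y} f :=
    { app := fun a => TypeCat.ofHom (f.right.app a.unop.n)
      naturality := fun a b φ => by
        ext x
        change f.right.app _ (Operad.psiMap X.hom φ.unop x) =
          Operad.psiMap Y.hom φ.unop (f.right.app _ x)
        rw [Operad.map_psiMap, Under.w] }

/-- The operad `𝔖` pointed by the units. -/
def symPointed : Under trivialOperad.{u} := Under.mk symUnit

/-- The functor `Ψ^𝔖 : (Op^{∗/})^{/𝔖} ⥤ Set_∇^{/Ψ(𝔖)}`. -/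
def psiSym : Over symPointed.{u} ⥤ Over (psi.obj symPointed.{u}) := Over.post psi

/-! ### Crossed groups -/

/-- A crossed `A`-group. The element `act g φ` is `φ^g`, and `X.map φ.op g` is `φ^*(g)`. -/
structure CrossedGroup (A : Type v) [SmallCategory A] where
  /-- the underlying presheaf -/
  X : Aᵒᵖ ⥤ Type u
  [group : ∀ a, Group (X.obj a)]
  /-- the action `(g, φ) ↦ φ^g` -/
  act {a b : A} (g : X.obj (op a)) (φ : b ⟶ a) : b ⟶ a
  one_act {a b : A} (φ : b ⟶ a) : act 1 φ = φ
  mul_act {a b : A} (g h : X.obj (op a)) (φ : b ⟶ a) : act (g * h) φ = act g (act h φ)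
  act_comp {a b c : A} (g : X.obj (op a)) (φ : b ⟶ a) (ψ : c ⟶ b) :
    act g (ψ ≫ φ) = act (X.map φ.op g) ψ ≫ act g φ
  map_mul {a b : A} (φ : b ⟶ a) (g h : X.obj (op a)) :
    X.map φ.op (g * h) = X.map (act h φ).op g * X.map φ.op h

attribute [instance] CrossedGroup.group

namespace CrossedGroup

variable {A : Type v} [SmallCategory A]

/-- A map of crossed `A`-groups. -/
@[ext]
structure Hom (G H : CrossedGroup.{v, u} A) where
  /-- the underlying map of presheaves -/
  hom : G.X ⟶ H.X
  map_mul {a : A} (g g' : G.X.obj (op a)) :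
    hom.app (op a) (g * g') = hom.app (op a) g * hom.app (op a) g'
  act_hom {a b : A} (g : G.X.obj (op a)) (φ : b ⟶ a) : H.act (hom.app (op a) g) φ = G.act g φ

/-- The category of crossed `A`-groups. -/
instance : Category (CrossedGroup.{v, u} A) where
  Hom := Hom
  id G := ⟨𝟙 G.X, fun _ _ => rfl, fun _ _ => rfl⟩
  comp f g := ⟨f.hom ≫ g.hom,
    fun x y => (congrArg _ (f.map_mul x y)).trans (g.map_mul _ _),
    fun x φ => (g.act_hom _ φ).trans (f.act_hom x φ)⟩

variable (G : CrossedGroup.{v, u} A)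

theorem act_id {a : A} (g : G.X.obj (op a)) : G.act g (𝟙 a) = 𝟙 a := by
  have h : ∀ ψ : a ⟶ a, G.act g ψ = G.act g ψ ≫ G.act g (𝟙 a) := fun ψ => by
    have := G.act_comp g (𝟙 a) ψ
    rwa [op_id, Functor.map_id_apply, Category.comp_id] at this
  have h1 := h (G.act g⁻¹ (𝟙 a))
  rw [← G.mul_act, mul_inv_cancel, G.one_act, Category.id_comp] at h1
  exact h1.symm

theorem map_one {a b : A} (φ : b ⟶ a) : G.X.map φ.op (1 : G.X.obj (op a)) = 1 := by
  have := G.map_mul φ 1 1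
  rw [G.one_act, mul_one] at this
  exact (mul_eq_left.1 this.symm)

end CrossedGroup

/-! ### The monoidal structure on presheaves over a crossed group -/

namespace PresheafOver

variable {A : Type v} [SmallCategory A] {G : CrossedGroup.{v, u} A}

theorem over_app {X Y : Over G.X} (f : X ⟶ Y) {a : Aᵒᵖ} (x : X.left.obj a) :
    Y.hom.app a (f.left.app a x) = X.hom.app a x :=
  ConcreteCategory.congr_hom (NatTrans.congr_app (Over.w f) a) x

theorem nat_app {X Y : Aᵒᵖ ⥤ Type u} (f : X ⟶ Y) {a b : Aᵒᵖ} (φ : a ⟶ b) (x : X.obj a) :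
    f.app b (X.map φ x) = Y.map φ (f.app a x) := ConcreteCategory.congr_hom (f.naturality φ) x

/-- The presheaf `X ⋊ Y`, for a presheaf `X` and a presheaf `ρ : Y ⟶ G` over `G`:
`φ^*(x, y) = ((φ^{ρ(y)})^*(x), φ^*(y))`. -/
def semi (X : Aᵒᵖ ⥤ Type u) (Y : Over G.X) : Aᵒᵖ ⥤ Type u where
  obj a := X.obj a × Y.left.obj a
  map {a b} φ := TypeCat.ofHom fun x =>
    (X.map (G.act (a := a.unop) (Y.hom.app a x.2) φ.unop).op x.1, Y.left.map φ x.2)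
  map_id a := by
    refine ConcreteCategory.hom_ext _ _ fun x => ?_
    refine Prod.ext ?_ (by exact Functor.map_id_apply Y.left a x.2)
    change X.map (G.act (a := a.unop) _ (𝟙 a.unop)).op x.1 = x.1
    rw [G.act_id, op_id, Functor.map_id_apply]
  map_comp {a b c} φ ψ := by
    refine ConcreteCategory.hom_ext _ _ fun x => ?_
    refine Prod.ext ?_ (by exact Functor.map_comp_apply Y.left φ ψ x.2)
    change X.map (G.act (a := a.unop) _ (ψ.unop ≫ φ.unop)).op x.1 =
      X.map (G.act (a := b.unop) (Y.hom.app b (Y.left.map φ x.2)) ψ.unop).op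
        (X.map (G.act (a := a.unop) _ φ.unop).op x.1)
    rw [G.act_comp, op_comp, Functor.map_comp_apply, nat_app]
    rfl

/-- The tensor product `⋊` on presheaves over `G`: the structure map of `X ⋊ Y` is the product of
those of `X` and of `Y`. -/
def tensor (X Y : Over G.X) : Over G.X :=
  Over.mk (Y := semi X.left Y)
    { app := fun a => TypeCat.ofHom fun x => X.hom.app a x.1 * Y.hom.app a x.2
      naturality := fun a b φ => by
        ext x
        change X.hom.app b (X.left.map _ x.1) * Y.hom.app b (Y.left.map φ x.2) =
          G.X.map φ (X.hom.app a x.1 * Y.hom.app a x.2)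
        rw [nat_app, nat_app]
        exact (G.map_mul (a := a.unop) (b := b.unop) φ.unop _ _).symm }

/-- The unit object: the terminal presheaf with the units of the groups. -/
def unit (G : CrossedGroup.{v, u} A) : Over G.X :=
  Over.mk (Y := (Functor.const _).obj PUnit)
    { app := fun _ => TypeCat.ofHom fun _ => 1
      naturality := fun a b φ => by
        ext x
        exact (G.map_one (a := a.unop) (b := b.unop) φ.unop).symm }

theorem hom_ext {X Y : Over G.X} {f g : X ⟶ Y} (h : ∀ a x, f.left.app a x = g.left.app a x) :
    f = g := by
  ext a x
  exact h a x

/-- Maps of presheaves over `G`, as families of functions. -/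
def homMk {X Y : Over G.X} (f : ∀ a, X.left.obj a → Y.left.obj a)
    (hf : ∀ {a b : Aᵒᵖ} (φ : a ⟶ b) (x : X.left.obj a),
      f b (X.left.map φ x) = Y.left.map φ (f a x))
    (w : ∀ a x, Y.hom.app a (f a x) = X.hom.app a x) : X ⟶ Y :=
  Over.homMk
    { app := fun a => TypeCat.ofHom (f a)
      naturality := fun a b φ => by ext x; exact hf φ x }
    (by ext a x; exact w a x)

/-- The tensor product `⋊` of maps: `(x, y) ↦ (f x, g y)`. -/
def tensorMap {X X' Y Y' : Over G.X} (f : X ⟶ X') (g : Y ⟶ Y') : tensor X Y ⟶ tensor X' Y' :=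
  homMk (fun a x => (f.left.app a x.1, g.left.app a x.2))
    (fun {a b} φ x => by
      refine Prod.ext ?_ (nat_app _ _ _)
      refine (nat_app _ _ _).trans ?_
      exact congrArg (fun t => X'.left.map (G.act (a := a.unop) t φ.unop).op (f.left.app a x.1))
        (over_app g x.2).symm)
    (fun a x => congrArg₂ (· * ·) (over_app f x.1) (over_app g x.2))

/-- An isomorphism of presheaves over `G` from a bijective map. -/
def isoOfEquiv {X Y : Over G.X} (f : X ⟶ Y) (g : ∀ a, Y.left.obj a → X.left.obj a)
    (hfg : ∀ a x, g a (f.left.app a x) = x) (hgf : ∀ a y, f.left.app a (g a y) = y) : X ≅ Y where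
  hom := f
  inv := homMk g
    (fun {a b} φ y => by rw [← hfg b (X.left.map φ (g a y)), nat_app, hgf])
    (fun a y => by rw [← over_app f, hgf])
  hom_inv_id := hom_ext hfg
  inv_hom_id := hom_ext hgf

/-- The associativity `((x, y), z) ↦ (x, (y, z))`. -/
def assoc (X Y Z : Over G.X) : tensor (tensor X Y) Z ≅ tensor X (tensor Y Z) :=
  isoOfEquiv
    (homMk (fun _ x => (x.1.1, x.1.2, x.2))
      (fun {a b} φ x => Prod.ext
        (congrArg (fun t : b.unop ⟶ a.unop => X.left.map t.op x.1.1)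
          (G.mul_act (a := a.unop) (b := b.unop) (Y.hom.app a x.1.2) (Z.hom.app a x.2)
            φ.unop).symm) rfl)
      (fun _ _ => (mul_assoc _ _ _).symm))
    (fun _ x => ((x.1, x.2.1), x.2.2)) (fun _ _ => rfl) (fun _ _ => rfl)

/-- The left unit isomorphism `(∗, x) ↦ x`. -/
def leftUnit (X : Over G.X) : tensor (unit G) X ≅ X :=
  isoOfEquiv (homMk (fun _ x => x.2) (fun _ _ => rfl) (fun _ _ => (one_mul _).symm))
    (fun _ x => (⟨⟩, x)) (fun _ _ => rfl) (fun _ _ => rfl)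

/-- The right unit isomorphism `(x, ∗) ↦ x`. -/
def rightUnit (X : Over G.X) : tensor X (unit G) ≅ X :=
  isoOfEquiv
    (homMk (fun _ x => x.1)
      (fun {a b} φ x => congrArg (fun t : b.unop ⟶ a.unop => X.left.map t.op x.1)
        (G.one_act (a := a.unop) (b := b.unop) φ.unop))
      (fun _ _ => (mul_one _).symm))
    (fun _ x => (x, ⟨⟩)) (fun _ _ => rfl) (fun _ _ => rfl)

/-- The monoidal structure `⋊` on the category of presheaves over a crossed group. -/
instance monoidal : MonoidalCategory (Over G.X) where
  tensorObj := tensor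
  whiskerLeft X _ _ f := tensorMap (𝟙 X) f
  whiskerRight f Y := tensorMap f (𝟙 Y)
  tensorHom := tensorMap
  tensorUnit := unit G
  associator := assoc
  leftUnitor := leftUnit
  rightUnitor := rightUnit
  tensorHom_def _ _ := hom_ext fun _ _ => rfl
  id_tensorHom_id _ _ := hom_ext fun _ _ => rfl
  tensorHom_comp_tensorHom _ _ _ _ := hom_ext fun _ _ => rfl
  whiskerLeft_id _ _ := hom_ext fun _ _ => rfl
  id_whiskerRight _ _ := hom_ext fun _ _ => rfl
  associator_naturality _ _ _ := hom_ext fun _ _ => rfl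
  leftUnitor_naturality _ := hom_ext fun _ _ => rfl
  rightUnitor_naturality _ := hom_ext fun _ _ => rfl
  pentagon _ _ _ _ := hom_ext fun _ _ => rfl
  triangle _ _ := hom_ext fun _ _ => rfl

end PresheafOver

/-! ### The crossed interval group `𝔚_∇` -/

/-- The permutation `β_n^ε`, where `β_n` is the order-reversion on `n` elements, and where the group
of order two is written as `ℤˣ = {1, -1}`. -/
def beta (ε : ℤˣ) (n : ℕ) : Equiv.Perm (Fin n) := if ε = 1 then 1 else Fin.revPerm

/-- The permutations `β_n^ε` form a map `∗ ⟶ 𝔖` of operads. -/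
def betaHom (ε : ℤˣ) : trivialOperad.{u} ⟶ symOperad.{u} where
  app n _ := ⟨beta ε n⟩
  map_one := congrArg ULift.up (Subsingleton.elim (α := Equiv.Perm (Fin 1)) _ _)
  map_comp k h _ _ := congrArg ULift.up (by
    unfold beta
    split_ifs
    · exact (permComp_one k h).symm
    · exact (permComp_rev k h).symm)

theorem betaHom_one : betaHom.{u} 1 = symUnit := Operad.hom_ext fun _ _ => rfl

theorem beta_mul (ε δ : ℤˣ) (n : ℕ) : beta (ε * δ) n = beta ε n * beta δ n := by
  rcases Int.units_eq_one_or ε with rfl | rfl <;> rcases Int.units_eq_one_or δ with rfl | rfl <;>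
    simp [beta]
  ext; simp

theorem perm_apply_inv {α : Type*} (σ : Equiv.Perm α) (x : α) : σ (σ⁻¹ x) = x :=
  Equiv.apply_symm_apply σ x

theorem permComp_ext {n m : ℕ} {k k' : Fin n → ℕ} (hk : ∀ i, k i = k' i) (h : ∑ i, k i = m)
    (h' : ∑ i, k' i = m) (σ : Equiv.Perm (Fin n)) {τ : ∀ i, Equiv.Perm (Fin (k i))}
    {τ' : ∀ i, Equiv.Perm (Fin (k' i))} (hτ : ∀ i, τ i ≍ τ' i) :
    permComp k h σ τ = permComp k' h' σ τ' := by
  obtain rfl : k = k' := funext hk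
  obtain rfl : τ = τ' := funext fun i => eq_of_heq (hτ i)
  rfl

/-- The set `W(ℤ/2, ℤ/2)ₙ = (𝔖ₙ ⋉ (ℤ/2)ⁿ) × ℤ/2`. -/
@[ext]
structure Weyl (n : ℕ) : Type u where
  /-- the component in `𝔖ₙ` -/
  perm : Equiv.Perm (Fin n)
  /-- the component in `(ℤ/2)ⁿ` -/
  sgn : Fin n → ℤˣ
  /-- the component in the second factor `ℤ/2` -/
  inf : ℤˣ

namespace Weyl

/-- The group structure
`(τ; y₁, …, yₙ; v) (σ; x₁, …, xₙ; u) = (τ σ; y_{σ(1)} x₁, …, y_{σ(n)} xₙ; v u)`. -/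
instance (n : ℕ) : Group (Weyl.{u} n) where
  mul g h := ⟨g.perm * h.perm, fun i => g.sgn (h.perm i) * h.sgn i, g.inf * h.inf⟩
  one := ⟨1, fun _ => 1, 1⟩
  inv g := ⟨g.perm⁻¹, fun i => (g.sgn (g.perm⁻¹ i))⁻¹, g.inf⁻¹⟩
  mul_assoc _ _ _ := Weyl.ext (mul_assoc _ _ _) (funext fun _ => mul_assoc _ _ _) (mul_assoc _ _ _)
  one_mul _ := Weyl.ext (one_mul _) (funext fun _ => one_mul _) (one_mul _)
  mul_one _ := Weyl.ext (mul_one _) (funext fun _ => mul_one _) (mul_one _)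
  inv_mul_cancel g := Weyl.ext (inv_mul_cancel _) (funext fun i => by
    change (g.sgn (g.perm⁻¹ (g.perm i)))⁻¹ * g.sgn i = 1
    simp) (inv_mul_cancel _)

variable {n : ℕ}

theorem mul_perm (g h : Weyl.{u} n) : (g * h).perm = g.perm * h.perm := rfl
theorem mul_sgn (g h : Weyl.{u} n) (i : Fin n) :
  (g * h).sgn i = g.sgn (h.perm i) * h.sgn i := rfl
theorem mul_inf (g h : Weyl.{u} n) : (g * h).inf = g.inf * h.inf := rfl

/-- The family `(x_{-∞}, x₁, …, xₙ, x_∞)` with `x_{-∞} = x_∞ = u`. -/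
def ext' (g : Weyl.{u} n) : Fin (n + 2) → ℤˣ :=
  Fin.cons g.inf (Fin.snoc (α := fun _ => ℤˣ) g.sgn g.inf)

theorem ext'_zero (g : Weyl.{u} n) : g.ext' 0 = g.inf := rfl
theorem ext'_last (g : Weyl.{u} n) : g.ext' (Fin.last (n + 1)) = g.inf := by
  simp [ext', ← Fin.succ_last]
theorem ext'_mid (g : Weyl.{u} n) (i : Fin n) : g.ext' (mid i) = g.sgn i := by
  simp [ext', mid]

/-- The inverse of the permutation of `⟪n⟫` with `j ↦ σ(j)` and `±∞ ↦ ±u∞`. -/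
def extInv (g : Weyl.{u} n) : Fin (n + 2) → Fin (n + 2) :=
  Fin.cons (if g.inf = 1 then 0 else Fin.last (n + 1))
    (Fin.snoc (α := fun _ => Fin (n + 2)) (fun i => mid (g.perm⁻¹ i))
      (if g.inf = 1 then Fin.last (n + 1) else 0))

theorem extInv_zero (g : Weyl.{u} n) :
    g.extInv 0 = if g.inf = 1 then 0 else Fin.last (n + 1) := rfl
theorem extInv_last (g : Weyl.{u} n) :
    g.extInv (Fin.last (n + 1)) = if g.inf = 1 then Fin.last (n + 1) else 0 := by
  simp [extInv, ← Fin.succ_last]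
theorem extInv_mid (g : Weyl.{u} n) (i : Fin n) : g.extInv (mid i) = mid (g.perm⁻¹ i) := by
  simp [extInv, mid]

theorem extInv_mul (g h : Weyl.{u} n) (j : Fin (n + 2)) :
    (g * h).extInv j = h.extInv (g.extInv j) := by
  rcases eq_mid j with rfl | rfl | ⟨i, rfl⟩
  · rw [extInv_zero, extInv_zero, mul_inf]
    rcases Int.units_eq_one_or g.inf with hg | hg <;>
      rcases Int.units_eq_one_or h.inf with hh | hh <;>
      simp [hg, hh, extInv_zero, extInv_last]
  · rw [extInv_last, extInv_last, mul_inf]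
    rcases Int.units_eq_one_or g.inf with hg | hg <;>
      rcases Int.units_eq_one_or h.inf with hh | hh <;>
      simp [hg, hh, extInv_zero, extInv_last]
  · rw [extInv_mid, extInv_mid, extInv_mid, mul_perm, mul_inv_rev]; rfl

theorem extInv_one (j : Fin (n + 2)) : (1 : Weyl.{u} n).extInv j = j := by
  have h1 : (1 : Weyl.{u} n).inf = 1 := rfl
  have h2 : (1 : Weyl.{u} n).perm = 1 := rfl
  rcases eq_mid j with rfl | rfl | ⟨i, rfl⟩
  · rw [extInv_zero, h1, if_pos rfl]
  · rw [extInv_last, h1, if_pos rfl]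
  · rw [extInv_mid, h2]; rfl

/-- The permutation of `⟪n⟫` with `j ↦ σ(j)` and `±∞ ↦ ±u∞`. -/
def hat (g : Weyl.{u} n) : Equiv.Perm (Fin (n + 2)) where
  toFun := g⁻¹.extInv
  invFun := g.extInv
  left_inv j := by rw [← extInv_mul, inv_mul_cancel, extInv_one]
  right_inv j := by rw [← extInv_mul, mul_inv_cancel, extInv_one]

theorem hat_inv (g : Weyl.{u} n) (j : Fin (n + 2)) : g.hat⁻¹ j = g.extInv j := rfl

theorem hat_mul (g h : Weyl.{u} n) : (g * h).hat = g.hat * h.hat := by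
  rw [← inv_inj, mul_inv_rev]
  ext j : 1
  exact extInv_mul g h j

theorem permComp_inv_val {n m : ℕ} (k : Fin n → ℕ) (h : ∑ i, k i = m) (σ : Equiv.Perm (Fin n))
    (τ : ∀ i, Equiv.Perm (Fin (k i))) (i j : Fin n) (hij : σ⁻¹ j = i) (b : Fin (k i)) {P Q : Fin m}
    (hP : (P : ℕ) = ∑ l, (if l < j then k (σ⁻¹ l) else 0) + b)
    (hQ : (Q : ℕ) = ∑ l, (if l < i then k l else 0) + ((τ i)⁻¹ b : Fin (k i))) :
    (permComp k h σ τ)⁻¹ P = Q := by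
  subst hij
  have h' : ∑ j, k (σ⁻¹ j) = m := (Equiv.sum_comp σ⁻¹ k).trans h
  obtain rfl : P = flat (fun j => k (σ⁻¹ j)) h' ⟨j, b⟩ := Fin.ext (by rw [hP, flat_val])
  obtain rfl : Q = flat k h ⟨σ⁻¹ j, (τ (σ⁻¹ j))⁻¹ b⟩ := Fin.ext (by rw [hQ, flat_val])
  exact permComp_inv k h σ τ h' j b

theorem permComp₃_one {n : ℕ} (h : ∑ i, ![1, n, 1] i = n + 2)
    (τ : ∀ i, Equiv.Perm (Fin (![1, n, 1] i))) :
    (permComp ![1, n, 1] h 1 τ)⁻¹ 0 = 0 ∧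
    (permComp ![1, n, 1] h 1 τ)⁻¹ (Fin.last (n + 1)) = Fin.last (n + 1) ∧
    ∀ i : Fin n, (permComp ![1, n, 1] h 1 τ)⁻¹ (mid i) =
      mid ((show Equiv.Perm (Fin n) from τ 1)⁻¹ i) := by
  have hs : ∀ a : Fin 1, (a : ℕ) = 0 := fun a => by omega
  refine ⟨permComp_inv_val _ h 1 τ 0 0 rfl (0 : Fin 1) ?_ ?_,
    permComp_inv_val _ h 1 τ 2 2 rfl (0 : Fin 1) ?_ ?_, fun i =>
    permComp_inv_val _ h 1 τ 1 1 rfl i ?_ ?_⟩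
  · simp
  · refine Eq.trans ?_ (congrArg₂ (· + ·) rfl (hs _).symm); simp
  · simp [Fin.sum_univ_three]; omega
  · refine Eq.trans ?_ (congrArg₂ (· + ·) rfl (hs _).symm); simp [Fin.sum_univ_three]; omega
  · simp [mid_val]; omega
  · rw [mid_val, add_comm]; refine congrArg₂ (· + ·) ?_ rfl; simp

theorem permComp₃_rev {n : ℕ} (h : ∑ i, ![1, n, 1] i = n + 2)
    (τ : ∀ i, Equiv.Perm (Fin (![1, n, 1] i))) :
    (permComp ![1, n, 1] h Fin.revPerm τ)⁻¹ 0 = Fin.last (n + 1) ∧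
    (permComp ![1, n, 1] h Fin.revPerm τ)⁻¹ (Fin.last (n + 1)) = 0 ∧
    ∀ i : Fin n, (permComp ![1, n, 1] h Fin.revPerm τ)⁻¹ (mid i) =
      mid ((show Equiv.Perm (Fin n) from τ 1)⁻¹ i) := by
  have hs : ∀ a : Fin 1, (a : ℕ) = 0 := fun a => by omega
  have hr : ∀ i : Fin 3, (Fin.revPerm : Equiv.Perm (Fin 3))⁻¹ i = Fin.rev i := fun _ => rfl
  have r0 : Fin.rev (0 : Fin 3) = 2 := rfl
  refine ⟨permComp_inv_val _ h Fin.revPerm τ 2 0 rfl (0 : Fin 1) ?_ ?_,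
    permComp_inv_val _ h Fin.revPerm τ 0 2 rfl (0 : Fin 1) ?_ ?_, fun i =>
    permComp_inv_val _ h Fin.revPerm τ 1 1 rfl i ?_ ?_⟩
  · simp
  · refine Eq.trans ?_ (congrArg₂ (· + ·) rfl (hs _).symm); simp [Fin.sum_univ_three]; omega
  · simp [Fin.sum_univ_three, hr, r0]; omega
  · refine Eq.trans ?_ (congrArg₂ (· + ·) rfl (hs _).symm); simp
  · simp [mid_val, hr, r0]; omega
  · rw [mid_val, add_comm]; refine congrArg₂ (· + ·) ?_ rfl; simp

theorem symOperad_hat (g : Weyl.{u} n) :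
    symOperad.{u}.hat (Operad.pt (betaHom g.inf) 3) ⟨g.perm⟩ = ⟨g.hat⟩ := by
  refine congrArg ULift.up ?_
  rw [← inv_inj]
  ext j : 1
  rw [hat_inv]
  have hk : ∑ i, ![1, n, 1] i = n + 2 := by simp [Fin.sum_univ_three]; omega
  change (permComp ![1, n, 1] hk (beta g.inf 3) _)⁻¹ j = _
  rcases Int.units_eq_one_or g.inf with hu | hu
  · have hb : beta g.inf 3 = 1 := if_pos hu
    rw [hb]
    rcases eq_mid j with rfl | rfl | ⟨i, rfl⟩
    · rw [extInv_zero, if_pos hu]; exact (permComp₃_one hk _).1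
    · rw [extInv_last, if_pos hu]; exact (permComp₃_one hk _).2.1
    · rw [extInv_mid]; exact (permComp₃_one hk _).2.2 i
  · have hu' : g.inf ≠ 1 := by rw [hu]; decide
    have hb : beta g.inf 3 = Fin.revPerm := if_neg hu'
    rw [hb]
    rcases eq_mid j with rfl | rfl | ⟨i, rfl⟩
    · rw [extInv_zero, if_neg hu']; exact (permComp₃_rev hk _).1
    · rw [extInv_last, if_neg hu']; exact (permComp₃_rev hk _).2.1
    · rw [extInv_mid]; exact (permComp₃_rev hk _).2.2 i

theorem ext_hat {g h : Weyl.{u} n} (h1 : g.hat = h.hat) (h2 : ∀ j, g.ext' j = h.ext' j) :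
    g = h := by
  have hi : g.inf = h.inf := h2 0
  refine Weyl.ext ?_ (funext fun i => by rw [← ext'_mid, h2, ext'_mid]) hi
  have hp := (symOperad_hat g).trans ((congrArg ULift.up h1).trans (symOperad_hat h).symm)
  rw [← hi] at hp
  exact congrArg ULift.down (Operad.hat_injective _ hp)

theorem ext'_hat (g h : Weyl.{u} n) (j : Fin (n + 2)) :
    (g * h).ext' j = g.ext' (h.hat j) * h.ext' j := by
  obtain ⟨i, rfl⟩ := h.hat⁻¹.surjective j
  rw [perm_apply_inv, hat_inv]
  rcases eq_mid i with rfl | rfl | ⟨i, rfl⟩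
  · rw [extInv_zero]; split_ifs <;> simp only [ext'_zero, ext'_last] <;> rfl
  · rw [extInv_last]; split_ifs <;> simp only [ext'_zero, ext'_last] <;> rfl
  · rw [extInv_mid, ext'_mid, ext'_mid, ext'_mid, mul_sgn, perm_apply_inv]

/-- The map `φ^*`, given by
`φ^*(σ; x₁, …, xₙ; u) =
  (γ(β₃ᵘ; β_{k_{-∞}}ᵘ, γ(σ; β_{k_1}^{x₁}, …, β_{k_n}^{xₙ}), β_{k_∞}ᵘ); x_{φ(1)}, …, x_{φ(m)}; u)`,
with `x_{±∞} = u`. -/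
def map {a b : Nabla} (φ : a ⟶ b) (g : Weyl.{u} b.n) : Weyl.{u} a.n where
  perm := (Operad.pull (betaHom g.inf) φ (⟨g.perm⟩ : symOperad.{u}.obj b.n)
    (fun i => ⟨beta (g.sgn i) (φ.k (mid i))⟩)).down
  sgn i := g.ext' (φ.toFun (mid i))
  inf := g.inf

theorem ext'_map {a b : Nabla} (φ : a ⟶ b) (g : Weyl.{u} b.n) (j : Fin (a.n + 2)) :
    (map φ g).ext' j = g.ext' (φ.toFun j) := by
  rcases eq_mid j with rfl | rfl | ⟨i, rfl⟩
  · rw [φ.map_bot]; rfl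
  · rw [φ.map_top, ext'_last, ext'_last]; rfl
  · rw [ext'_mid]; rfl

theorem hat_map {a b : Nabla} (φ : a ⟶ b) (g : Weyl.{u} b.n) :
    (map φ g).hat =
      permComp φ.card φ.sum_card g.hat (fun j => beta (g.ext' j) (φ.card j)) := by
  have h1 := symOperad_hat (map φ g)
  have h2 := Operad.hat_pull (betaHom.{u} g.inf) φ (⟨g.perm⟩ : symOperad.{u}.obj b.n)
    (fun i => ⟨beta (g.sgn i) (φ.k (mid i))⟩) (fun j => ⟨beta (g.ext' j) (φ.card j)⟩)
    (by rw [ext'_zero]; rfl) (by rw [ext'_last]; rfl) (fun i => by rw [ext'_mid, φ.k_mid]; rfl)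
  rw [symOperad_hat g] at h2
  exact congrArg ULift.down (h1.symm.trans h2)

theorem map_id {a : Nabla} (g : Weyl.{u} a.n) : map (𝟙 a) g = g := by
  refine ext_hat ?_ fun j => ext'_map _ _ _
  rw [hat_map]
  have := (symOperad.{u}.comp_ext (k' := fun _ => 1) (Nabla.Hom.card_id a)
    (Nabla.Hom.sum_card (𝟙 a)) (by simp) ⟨g.hat⟩
    (y := fun j => ⟨beta (g.ext' j) (Nabla.Hom.card (𝟙 a) j)⟩) (y' := fun _ => ⟨1⟩)
    (fun j => by
      rw [Nabla.Hom.card_id]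
      exact heq_of_eq (congrArg ULift.up (Subsingleton.elim _ _)))).trans
    (symOperad.{u}.comp_one _ _)
  exact congrArg ULift.down this

theorem map_comp {a b c : Nabla} (ψ : a ⟶ b) (φ : b ⟶ c) (g : Weyl.{u} c.n) :
    map (ψ ≫ φ) g = map ψ (map φ g) := by
  refine ext_hat ?_ fun j => by rw [ext'_map, ext'_map, ext'_map]; rfl
  rw [hat_map, hat_map, hat_map, permComp_assoc _ _ _ _ (Nabla.Hom.card (ψ ≫ φ))
    (Nabla.Hom.sum_card _) (Nabla.Hom.card_comp ψ φ)]
  refine congrArg _ (funext fun j => ?_)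
  simp only [ext'_map, φ.apply_flat]
  exact (congrArg ULift.down (Operad.comp_pt (betaHom.{u} (g.ext' j)) _
    (Nabla.Hom.card_comp ψ φ j))).symm

/-- The action on `∇`: `φ^{(σ; x; u)}` is the morphism with
`k_{±∞}^{(φ^{(σ; x; u)})} = k_{±u∞}^{(φ)}` and `k_j^{(φ^{(σ; x; u)})} = k_{σ⁻¹(j)}^{(φ)}`. -/
def act {a b : Nabla} (g : Weyl.{u} b.n) (φ : a ⟶ b) : a ⟶ b :=
  Nabla.Hom.ofCard a b (fun j => φ.card (g.extInv j))
    (sum_perm g.hat⁻¹ φ.sum_card)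
    (by
      rw [extInv_zero]
      split_ifs
      exacts [φ.card_zero_pos, φ.card_last_pos])
    (by
      rw [extInv_last]
      split_ifs
      exacts [φ.card_last_pos, φ.card_zero_pos])

theorem card_act {a b : Nabla} (g : Weyl.{u} b.n) (φ : a ⟶ b) (j : Fin (b.n + 2)) :
    (act g φ).card j = φ.card (g.extInv j) := Nabla.Hom.card_ofCard _ _ _ _ j

theorem one_act {a b : Nabla} (φ : a ⟶ b) : act (1 : Weyl.{u} b.n) φ = φ :=
  Nabla.Hom.ext_card fun j => by rw [card_act, extInv_one]

theorem mul_act {a b : Nabla} (g h : Weyl.{u} b.n) (φ : a ⟶ b) :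
    act (g * h) φ = act g (act h φ) :=
  Nabla.Hom.ext_card fun j => by rw [card_act, card_act, card_act, extInv_mul]

theorem hat_map_inv {a b : Nabla} (φ : a ⟶ b) (g : Weyl.{u} b.n) (j : Fin (b.n + 2))
    (x : Fin (φ.card (g.extInv j))) :
    (map φ g).hat⁻¹ (flat (act g φ).card (act g φ).sum_card
      ⟨j, Fin.cast (card_act g φ j).symm x⟩) =
      flat φ.card φ.sum_card ⟨g.extInv j, (beta (g.ext' (g.extInv j)) _)⁻¹ x⟩ := by
  rw [hat_map, flat_congr (funext (card_act g φ)) _ (sum_perm g.hat⁻¹ φ.sum_card)]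
  exact permComp_inv φ.card φ.sum_card g.hat _ _ j x

theorem act_hat {a b : Nabla} (φ : a ⟶ b) (g : Weyl.{u} b.n) (p : Fin (a.n + 2)) :
    (act g φ).toFun ((map φ g).hat p) = g.hat (φ.toFun p) := by
  obtain ⟨q, rfl⟩ := (map φ g).hat⁻¹.surjective p
  rw [perm_apply_inv]
  obtain ⟨⟨j, x⟩, rfl⟩ := (flat (act g φ).card (act g φ).sum_card).surjective q
  obtain ⟨x, rfl⟩ : ∃ y, x = Fin.cast (card_act g φ j).symm y := ⟨Fin.cast (card_act g φ j) x, rfl⟩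
  rw [hat_map_inv, Nabla.Hom.apply_flat, Nabla.Hom.apply_flat, ← hat_inv,
    perm_apply_inv]

theorem act_comp {a b c : Nabla} (g : Weyl.{u} c.n) (φ : b ⟶ c) (ψ : a ⟶ b) :
    act g (ψ ≫ φ) = act (map φ g) ψ ≫ act g φ := by
  refine Nabla.Hom.ext_card fun j => ?_
  rw [card_act, ← Nabla.Hom.card_comp, ← Nabla.Hom.card_comp]
  simp only [card_act]
  rw [← Equiv.sum_comp (beta (g.ext' (g.extInv j)) (φ.card (g.extInv j)))⁻¹,
    ← Equiv.sum_comp (finCongr (card_act g φ j).symm)]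
  refine Finset.sum_congr rfl fun x _ => ?_
  exact congrArg ψ.card (hat_map_inv φ g j x).symm

theorem map_mul {a b : Nabla} (φ : a ⟶ b) (g h : Weyl.{u} b.n) :
    map φ (g * h) = map (act h φ) g * map φ h := by
  refine ext_hat ?_ fun j => by
    rw [ext'_map, ext'_hat, ext'_hat, ext'_map, ext'_map, act_hat]
  rw [hat_map, hat_mul, hat_mul, hat_map, hat_map]
  simp only [ext'_hat, beta_mul]
  rw [permComp_mul φ.card φ.sum_card g.hat h.hat (fun j => beta (g.ext' (h.hat j)) (φ.card j))
    (fun j => beta (h.ext' j) (φ.card j)) (sum_perm h.hat⁻¹ φ.sum_card)]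
  refine congrArg (· * _) (permComp_ext (fun j => (card_act h φ j).symm) _ _ _ fun j => ?_)
  rw [perm_apply_inv, card_act]
  rfl

end Weyl

/-- The crossed interval group `𝔚_∇ = W(ℤ/2, ℤ/2)`. -/
def weyl : CrossedGroup.{0, u} Nabla where
  X :=
    { obj := fun a => Weyl.{u} a.unop.n
      map := fun φ => TypeCat.ofHom (Weyl.map φ.unop)
      map_id := fun _ => ConcreteCategory.hom_ext _ _ fun g => Weyl.map_id g
      map_comp := fun φ ψ => ConcreteCategory.hom_ext _ _ fun g =>
        Weyl.map_comp ψ.unop φ.unop g }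
  group a := inferInstanceAs (Group (Weyl.{u} a.unop.n))
  act g φ := Weyl.act g φ
  one_act φ := Weyl.one_act φ
  mul_act g h φ := Weyl.mul_act g h φ
  act_comp g φ ψ := Weyl.act_comp g φ ψ
  map_mul φ g h := Weyl.map_mul φ g h

/-! ### The crossed interval group `𝔖` -/

/-- The element `(σ; 1, …, 1; 1)` of `𝔚_∇`. -/
def Weyl.ofPerm {n : ℕ} (σ : Equiv.Perm (Fin n)) : Weyl.{u} n := ⟨σ, fun _ => 1, 1⟩

theorem Weyl.ofPerm_mul {n : ℕ} (σ τ : Equiv.Perm (Fin n)) :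
    Weyl.ofPerm.{u} (σ * τ) = Weyl.ofPerm σ * Weyl.ofPerm τ := rfl

theorem Weyl.ofPerm_map {a b : Nabla} (φ : a ⟶ b) (σ : symOperad.{u}.obj b.n) :
    Weyl.ofPerm.{u} (Operad.psiMap symUnit φ σ).down = Weyl.map φ (Weyl.ofPerm σ.down) := by
  refine Weyl.ext ?_ (funext fun i => ?_) rfl
  · change _ = (Operad.pull (betaHom 1) φ σ _).down
    rw [betaHom_one]
    rfl
  · change 1 = Weyl.ext' (Weyl.ofPerm σ.down) (φ.toFun (mid i))
    rcases eq_mid (φ.toFun (mid i)) with h | h | ⟨j, h⟩ <;> rw [h]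
    · rfl
    · rw [Weyl.ext'_last]; rfl
    · rw [Weyl.ext'_mid]; rfl

/-- The group structure on the permutation groups. -/
instance symGroup (n : ℕ) : Group (symOperad.{u}.obj n) :=
  inferInstanceAs (Group (ULift.{u} (Equiv.Perm (Fin n))))

theorem sym_mul_down {n : ℕ} (g h : symOperad.{u}.obj n) : (g * h).down = g.down * h.down := rfl

/-- The action of `𝔖` on `∇`: `σ` acts by permuting `k₁, …, kₙ`, that is, as the element
`(σ; 1, …, 1; 1)` of `𝔚_∇`. -/
def symAct {a b : Nabla} (g : symOperad.{u}.obj b.n) (φ : a ⟶ b) : a ⟶ b :=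
  Weyl.act.{u} (Weyl.ofPerm g.down) φ

theorem symAct_one {a b : Nabla} (φ : a ⟶ b) : symAct.{u} 1 φ = φ := Weyl.one_act.{u} φ

theorem symAct_mul {a b : Nabla} (g h : symOperad.{u}.obj b.n) (φ : a ⟶ b) :
    symAct (g * h) φ = symAct g (symAct h φ) := by
  unfold symAct
  rw [sym_mul_down, Weyl.ofPerm_mul, Weyl.mul_act]

theorem symAct_comp {a b c : Nabla} (g : symOperad.{u}.obj c.n) (φ : b ⟶ c) (ψ : a ⟶ b) :
    symAct g (ψ ≫ φ) = symAct (Operad.psiMap symUnit φ g) ψ ≫ symAct g φ := by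
  unfold symAct
  rw [Weyl.ofPerm_map, Weyl.act_comp]

theorem symMap_mul {a b : Nabla} (φ : a ⟶ b) (g h : symOperad.{u}.obj b.n) :
    Operad.psiMap symUnit.{u} φ (g * h) =
      Operad.psiMap symUnit.{u} (symAct h φ) g * Operad.psiMap symUnit.{u} φ h := by
  have key : Weyl.ofPerm.{u} (Operad.psiMap symUnit.{u} φ (g * h)).down =
      Weyl.ofPerm (Operad.psiMap symUnit.{u} (symAct h φ) g *
        Operad.psiMap symUnit.{u} φ h).down := by
    rw [Weyl.ofPerm_map, sym_mul_down, sym_mul_down, Weyl.ofPerm_mul, Weyl.ofPerm_mul,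
      Weyl.ofPerm_map, Weyl.ofPerm_map, Weyl.map_mul]
    rfl
  exact ULift.ext _ _ (congrArg Weyl.perm key)

/-- The crossed interval group `𝔖 = W(∗, ∗)`: its underlying interval set is `Ψ(𝔖)`, and it
consists of the permutation groups. -/
def symCrossed : CrossedGroup.{0, u} Nabla where
  X := psi.obj symPointed
  group a := symGroup a.unop.n
  act g φ := symAct g φ
  one_act φ := symAct_one φ
  mul_act g h φ := symAct_mul g h φ
  act_comp g φ ψ := symAct_comp g φ ψ
  map_mul φ g h := symMap_mul φ g h

/-- The inclusion `𝔖 ⟶ 𝔚_∇`. -/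
def symToWeyl : symCrossed.{u} ⟶ weyl.{u} where
  hom :=
    { app := fun _ => TypeCat.ofHom fun g => Weyl.ofPerm (ULift.down g)
      naturality := fun _ _ φ => ConcreteCategory.hom_ext _ _ fun g =>
        Weyl.ofPerm_map φ.unop g }
  map_mul _ _ := rfl
  act_hom _ _ := rfl

/-! ### Group operads -/

/-- A group operad. -/
structure GrpOp : Type (u + 1) where
  /-- the underlying operad -/
  X : Operad.{u}
  [group : ∀ n, Group (X.obj n)]
  /-- the structure map to the operad of permutation groups -/
  hom : X ⟶ symOperad
  hom_mul {n : ℕ} (x y : X.obj n) : hom.app n (x * y) = hom.app n x * hom.app n y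
  comp_mul {n m : ℕ} (k : Fin n → ℕ) (h : ∑ i, k i = m) (x y : X.obj n)
    (xs ys : ∀ i, X.obj (k i)) :
    X.comp k h (x * y) (fun i => xs i * ys i) =
      X.comp (fun i => k ((Operad.perm hom y)⁻¹ i)) (sum_perm _ h) x
        (fun i => xs ((Operad.perm hom y)⁻¹ i)) * X.comp k h y ys

attribute [instance] GrpOp.group

namespace GrpOp

/-- A map of group operads. -/
@[ext]
structure Hom (G H : GrpOp.{u}) where
  /-- the underlying map of operads -/
  hom : G.X ⟶ H.X
  map_mul {n : ℕ} (x y : G.X.obj n) : hom.app n (x * y) = hom.app n x * hom.app n y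
  w : hom ≫ H.hom = G.hom

/-- The category `GrpOp` of group operads. -/
instance : Category GrpOp.{u} where
  Hom := Hom
  id G := ⟨𝟙 G.X, fun _ _ => rfl, Category.id_comp _⟩
  comp f g := ⟨f.hom ≫ g.hom,
    fun x y => (congrArg _ (f.map_mul x y)).trans (g.map_mul _ _),
    by rw [Category.assoc, g.w, f.w]⟩

variable (G : GrpOp.{u})

theorem perm_mul {n : ℕ} (x y : G.X.obj n) :
    Operad.perm G.hom (x * y) = Operad.perm G.hom x * Operad.perm G.hom y :=
  congrArg ULift.down (G.hom_mul x y)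

theorem perm_one (n : ℕ) : Operad.perm G.hom (1 : G.X.obj n) = 1 := by
  have := G.perm_mul (1 : G.X.obj n) 1
  rw [mul_one] at this
  exact mul_eq_left.1 this.symm

theorem comp_one_one {n m : ℕ} (k : Fin n → ℕ) (h : ∑ i, k i = m) :
    G.X.comp k h 1 (fun _ => 1) = 1 := by
  have h1 := G.comp_mul k h 1 1 (fun _ => 1) (fun _ => 1)
  have h2 := G.X.comp_idx k (fun i => (1 : G.X.obj (k i))) 1
    (f := fun i => (Operad.perm G.hom (1 : G.X.obj n))⁻¹ i) (g := fun i => i)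
    (fun i => by rw [G.perm_one]; rfl) (sum_perm _ h) h
  simp only [mul_one] at h1
  exact mul_eq_right.1 ((congrArg (· * G.X.comp k h 1 fun _ => 1) h2.symm).trans h1.symm)

theorem one_eq : (1 : G.X.obj 1) = G.X.one := by
  have h1 : ∑ _i : Fin 1, 1 = 1 := by simp
  have := G.comp_mul (fun _ : Fin 1 => 1) h1 1 G.X.one (fun _ => G.X.one) (fun _ => 1)
  simp only [mul_one, one_mul] at this
  rw [G.X.one_comp, G.X.comp_one, G.X.one_comp, mul_one] at this
  exact this.symm

/-- The monoid operad given by a group operad. -/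
def toMonOp : MonOp.{u} where
  X := Over.mk G.hom
  mon :=
    { one := Over.homMk
        { app := fun n _ => (1 : G.X.obj n)
          map_one := G.one_eq
          map_comp := fun k h _ _ => (G.comp_one_one k h).symm }
        (Operad.hom_ext fun n _ => congrArg ULift.up (G.perm_one n))
      mul := Over.homMk
        { app := fun n x => (show G.X.obj n from x.1) * (show G.X.obj n from x.2)
          map_one := by
            change G.X.one * G.X.one = G.X.one
            rw [← G.one_eq, mul_one]
          map_comp := fun k h x y =>
            (G.comp_mul k h x.1 x.2 (fun i => (y i).1) (fun i => (y i).2)).symm }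
        (Operad.hom_ext fun n x => G.hom_mul x.1 x.2)
      one_mul := Over.OverMorphism.ext
        (Operad.hom_ext fun n x => one_mul (M := G.X.obj n) x.2)
      mul_one := Over.OverMorphism.ext
        (Operad.hom_ext fun n x => mul_one (M := G.X.obj n) x.1)
      mul_assoc := Over.OverMorphism.ext
        (Operad.hom_ext fun n x => mul_assoc (G := G.X.obj n) x.1.1 x.1.2 x.2) }

theorem map_one {G H : GrpOp.{u}} (f : G ⟶ H) (n : ℕ) : f.hom.app n 1 = 1 := by
  have := f.map_mul (1 : G.X.obj n) 1
  rw [mul_one] at this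
  exact mul_eq_left.1 this.symm

end GrpOp

/-- The functor `GrpOp ⥤ MonOp`. -/
def grpOpToMonOp : GrpOp.{u} ⥤ MonOp.{u} where
  obj G := G.toMonOp
  map {G H} f := Mon.Hom.mk' (M := G.toMonOp) (N := H.toMonOp) (Over.homMk f.hom f.w)
    (Over.OverMorphism.ext (Operad.hom_ext fun n _ => GrpOp.map_one f n))
    (Over.OverMorphism.ext (Operad.hom_ext fun _ x => f.map_mul x.1 x.2))

/-! ### Crossed interval monoids -/

/-- The category `CrsMon_∇` of crossed interval monoids: monoid objects in
`(Set_∇^{/𝔚_∇}, ⋊)`. -/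
abbrev CrsMon : Type (u + 1) := Mon (Over weyl.{u}.X)

namespace CrossedGroup

theorem hom_map_one {G H : CrossedGroup.{0, u} Nabla} (f : G ⟶ H) (a : Nablaᵒᵖ) :
    f.hom.app a (1 : G.X.obj a) = 1 := by
  have := f.map_mul (a := a.unop) (1 : G.X.obj a) 1
  rw [mul_one] at this
  exact mul_eq_left.1 this.symm

/-- The crossed interval monoid given by a crossed interval group with a map to `𝔚_∇`. -/
def toCrsMon {G : CrossedGroup.{0, u} Nabla} (f : G ⟶ weyl) : CrsMon.{u} where
  X := Over.mk f.hom
  mon :=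
    { one := PresheafOver.homMk (fun a _ => (1 : G.X.obj a))
        (fun {a b} φ _ => (G.map_one (a := a.unop) (b := b.unop) φ.unop).symm)
        (fun a _ => hom_map_one f a)
      mul := PresheafOver.homMk
        (fun a x => (show G.X.obj a from x.1) * (show G.X.obj a from x.2))
        (fun {a b} φ x => by
          refine Eq.trans ?_ (G.map_mul (a := a.unop) (b := b.unop) φ.unop x.1 x.2).symm
          refine congrArg (fun t : b.unop ⟶ a.unop => G.X.map t.op x.1 * G.X.map φ x.2) ?_
          exact f.act_hom (a := a.unop) (b := b.unop) x.2 φ.unop)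
        (fun a x => f.map_mul (a := a.unop) x.1 x.2)
      one_mul := PresheafOver.hom_ext fun a x => one_mul (M := G.X.obj a) x.2
      mul_one := PresheafOver.hom_ext fun a x => mul_one (M := G.X.obj a) x.1
      mul_assoc := PresheafOver.hom_ext fun a x =>
        mul_assoc (G := G.X.obj a) x.1.1 x.1.2 x.2 }

/-- Functoriality of the crossed interval monoid given by a crossed interval group. -/
def toCrsMonMap {G H : CrossedGroup.{0, u} Nabla} (f : G ⟶ weyl) (g : H ⟶ weyl) (p : G ⟶ H)
    (w : p ≫ g = f) : toCrsMon f ⟶ toCrsMon g :=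
  Mon.Hom.mk' (M := toCrsMon f) (N := toCrsMon g)
    (Over.homMk p.hom (congrArg Hom.hom w))
    (PresheafOver.hom_ext fun a _ => hom_map_one p a)
    (PresheafOver.hom_ext fun a x => p.map_mul (a := a.unop) x.1 x.2)

end CrossedGroup

/-- The crossed interval group `𝔖` as a crossed interval monoid. -/
def symCrsMon : CrsMon.{u} := CrossedGroup.toCrsMon symToWeyl

/-- The functor `CrsGrp_∇^{/𝔖} ⥤ CrsMon_∇^{/𝔖}`. -/
def crsGrpToCrsMon : Over symCrossed.{u} ⥤ Over symCrsMon.{u} where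
  obj G := Over.mk (CrossedGroup.toCrsMonMap (G.hom ≫ symToWeyl) symToWeyl G.hom rfl)
  map {G H} f := Over.homMk
    (CrossedGroup.toCrsMonMap (G.hom ≫ symToWeyl) (H.hom ≫ symToWeyl) f.left
      (by rw [← Category.assoc, Over.w]))
    (Mon.Hom.ext (Over.OverMorphism.ext (congrArg CrossedGroup.Hom.hom (Over.w f))))
  map_id _ := rfl
  map_comp _ _ := rfl

/-! ### The functor `Ψ̂` -/

namespace Operad

theorem comp_heq (X : Operad.{u}) {n m m' : ℕ} {k k' : Fin n → ℕ} (hk : ∀ i, k i = k' i)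
    (h : ∑ i, k i = m) (h' : ∑ i, k' i = m') (x : X.obj n) {y : ∀ i, X.obj (k i)}
    {y' : ∀ i, X.obj (k' i)} (hm : m = m') (hy : ∀ i, y i ≍ y' i) :
    X.comp k h x y ≍ X.comp k' h' x y' := by
  subst hm
  exact heq_of_eq (X.comp_ext hk h h' x hy)

theorem comp₃_congr (X : Operad.{u}) {a a' b b' c c' m : ℕ} (ha : a = a') (hb : b = b')
    (hc : c = c') (h : a + b + c = m) (h' : a' + b' + c' = m) (t : X.obj 3)
    {x : X.obj a} {x' : X.obj a'} (hx : x ≍ x') {y : X.obj b} {y' : X.obj b'} (hy : y ≍ y')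
    {z : X.obj c} {z' : X.obj c'} (hz : z ≍ z') : X.comp₃ h t x y z = X.comp₃ h' t x' y' z' := by
  subst ha hb hc
  rw [eq_of_heq hx, eq_of_heq hy, eq_of_heq hz]

variable {X Y : Operad.{u}}

/-- The base points of `X ⋊ Y`. -/
def semiPt (ρ : Y ⟶ symOperad) (e : trivialOperad ⟶ X) (e' : trivialOperad ⟶ Y)
    (w : e' ≫ ρ = symUnit) : trivialOperad ⟶ X.semi ρ where
  app n _ := (pt e n, pt e' n)
  map_one := Prod.ext e.map_one e'.map_one
  map_comp {n m} k h _ _ := by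
    refine Prod.ext ?_ (comp_pt e' k h).symm
    have hρ : perm ρ (pt e' n) = 1 := congrArg ULift.down (hom_congr w n ⟨⟩)
    refine ((X.comp_idx k (fun i => pt e (k i)) (pt e n) (g := fun i => i)
      (fun i => by rw [hρ]; rfl) (sum_perm _ h) h).trans (comp_pt e k h)).symm

theorem k_symAct {a b : Nabla} (g : symOperad.{u}.obj b.n) (φ : a ⟶ b) :
    Nabla.Hom.k (symAct g φ) 0 = φ.k 0 ∧
    Nabla.Hom.k (symAct g φ) (Fin.last (b.n + 1)) = φ.k (Fin.last (b.n + 1)) ∧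
    ∀ i, Nabla.Hom.k (symAct g φ) (mid i) = φ.k (mid (g.down⁻¹ i)) := by
  have h1 : (Weyl.ofPerm.{u} g.down).inf = 1 := rfl
  unfold symAct
  refine ⟨?_, ?_, fun i => ?_⟩
  · rw [Nabla.Hom.k_zero, Nabla.Hom.k_zero, Weyl.card_act, Weyl.extInv_zero, if_pos h1]
  · rw [Nabla.Hom.k_last, Nabla.Hom.k_last, Weyl.card_act, Weyl.extInv_last, if_pos h1]
  · rw [Nabla.Hom.k_mid, Nabla.Hom.k_mid, Weyl.card_act, Weyl.extInv_mid]
    rfl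

theorem semi_comp₃ (ρ : Y ⟶ symOperad) {a b c m : ℕ} (h : a + b + c = m) (t : (X.semi ρ).obj 3)
    (ht : perm ρ t.2 = 1) (x : (X.semi ρ).obj a) (y : (X.semi ρ).obj b) (z : (X.semi ρ).obj c) :
    (X.semi ρ).comp₃ h t x y z = (X.comp₃ h t.1 x.1 y.1 z.1, Y.comp₃ h t.2 x.2 y.2 z.2) := by
  have hk : ∑ i, ![a, b, c] i = m := by simp [Fin.sum_univ_three, h]
  let w : ∀ i : Fin 3, (X.semi ρ).obj (![a, b, c] i) := fun | 0 => x | 1 => y | 2 => z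
  refine Prod.ext ?_ ?_
  · refine (X.comp_idx ![a, b, c] (fun i => (w i).1) t.1 (f := fun i => (perm ρ t.2)⁻¹ i)
      (g := fun i => i) (fun i => by rw [ht]; rfl) (sum_perm _ hk) hk).trans ?_
    refine X.comp_ext (fun _ => rfl) _ _ _ fun i => ?_
    fin_cases i <;> rfl
  · refine Y.comp_ext (fun _ => rfl) _ _ _ fun i => ?_
    fin_cases i <;> rfl

/-- The equality `Ψ(X ⋊ Y) = Ψ(X) ⋊ Ψ(Y)` of interval sets. -/
theorem psiMap_semi (ρ : Y ⟶ symOperad) (e : trivialOperad ⟶ X) (e' : trivialOperad ⟶ Y)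
    (w : e' ≫ ρ = symUnit) {a b : Nabla} (φ : a ⟶ b) (x : X.obj b.n) (y : Y.obj b.n) :
    psiMap (semiPt ρ e e' w) φ (x, y) =
      (psiMap e (symAct (ρ.app b.n y) φ) x, psiMap e' φ y) := by
  have hρ : perm ρ (pt e' 3) = 1 := congrArg ULift.down (hom_congr w 3 ⟨⟩)
  obtain ⟨h0, h1, h2⟩ := k_symAct (ρ.app b.n y) φ
  have hs : ∑ i, Nabla.Hom.k (symAct (ρ.app b.n y) φ) (mid i) = ∑ i, φ.k (mid i) := by
    simp only [h2]
    exact Equiv.sum_comp (ρ.app b.n y).down⁻¹ fun i => φ.k (mid i)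
  refine (semi_comp₃ ρ φ.sum_k _ hρ _ _ _).trans (Prod.ext ?_ rfl)
  exact X.comp₃_congr h0.symm hs.symm h1.symm φ.sum_k
    (Nabla.Hom.sum_k (symAct (ρ.app b.n y) φ)) _ (pt_congr e h0.symm)
    (X.comp_heq (fun i => (h2 i).symm) _ _ _ hs.symm fun i => pt_congr e (h2 i).symm)
    (pt_congr e h1.symm)

end Operad

namespace MonOp

variable (M : MonOp.{u})

/-- The unit `∗ ⟶ M` of a monoid operad, as a map of operads. -/
def unit : trivialOperad ⟶ M.X.left := CommaMorphism.left M.mon.one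

/-- The multiplication `M ⋊ M ⟶ M` of a monoid operad, as a map of operads. -/
def mul : M.X.left.semi M.X.hom ⟶ M.X.left := CommaMorphism.left M.mon.mul

theorem unit_hom : M.unit ≫ M.X.hom = symUnit := Over.w M.mon.one

theorem mul_hom (n : ℕ) (x : (M.X.left.semi M.X.hom).obj n) :
    M.X.hom.app n (M.mul.app n x) = M.X.hom.app n x.1 * M.X.hom.app n x.2 :=
  Operad.hom_congr (Over.w M.mon.mul) n x

theorem one_mul (n : ℕ) (x : M.X.left.obj n) : M.mul.app n (M.unit.app n ⟨⟩, x) = x :=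
  Operad.hom_congr (congrArg CommaMorphism.left M.mon.one_mul) n (⟨⟩, x)

theorem mul_one (n : ℕ) (x : M.X.left.obj n) : M.mul.app n (x, M.unit.app n ⟨⟩) = x :=
  Operad.hom_congr (congrArg CommaMorphism.left M.mon.mul_one) n (x, ⟨⟩)

theorem mul_assoc (n : ℕ) (x y z : M.X.left.obj n) :
    M.mul.app n (M.mul.app n (x, y), z) = M.mul.app n (x, M.mul.app n (y, z)) :=
  Operad.hom_congr (congrArg CommaMorphism.left M.mon.mul_assoc) n ((x, y), z)

theorem semiPt_mul : Operad.semiPt M.X.hom M.unit M.unit M.unit_hom ≫ M.mul = M.unit :=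
  Operad.hom_ext fun n _ => M.one_mul n _

/-- The multiplication is a map `Ψ(M) ⋊ Ψ(M) = Ψ(M ⋊ M) ⟶ Ψ(M)` of interval sets. -/
theorem mul_psiMap {a b : Nabla} (φ : a ⟶ b) (x y : M.X.left.obj b.n) :
    M.mul.app a.n (Operad.psiMap M.unit (symAct (M.X.hom.app b.n y) φ) x,
      Operad.psiMap M.unit φ y) = Operad.psiMap M.unit φ (M.mul.app b.n (x, y)) := by
  refine (congrArg (M.mul.app a.n)
    (Operad.psiMap_semi M.X.hom M.unit M.unit M.unit_hom φ x y).symm).trans ?_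
  exact (Operad.map_psiMap M.mul _ φ _).trans
    (congrArg (fun e => Operad.psiMap e φ (M.mul.app b.n (x, y))) M.semiPt_mul)

theorem map_unit {M N : MonOp.{u}} (f : M ⟶ N) : M.unit ≫ f.hom.left = N.unit :=
  congrArg CommaMorphism.left f.isMonHom_hom.one_hom

theorem map_mul {M N : MonOp.{u}} (f : M ⟶ N) (n : ℕ) (x y : M.X.left.obj n) :
    f.hom.left.app n (M.mul.app n (x, y)) =
      N.mul.app n (f.hom.left.app n x, f.hom.left.app n y) :=
  Operad.hom_congr (congrArg CommaMorphism.left f.isMonHom_hom.mul_hom) n (x, y)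

end MonOp

/-- The functor `MonOp ⥤ (Op^{∗/})^{/𝔖}`: a monoid operad is a pointed operad by its unit. -/
def monOpToPointed : MonOp.{u} ⥤ Over symPointed.{u} where
  obj M := Over.mk (Under.homMk M.X.hom M.unit_hom : Under.mk M.unit ⟶ symPointed)
  map f := Over.homMk (Under.homMk f.hom.left (MonOp.map_unit f))
    (Under.UnderMorphism.ext (Over.w f.hom))
  map_id _ := rfl
  map_comp _ _ := rfl

namespace MonOp

variable (M : MonOp.{u})

/-- The interval set `Ψ^𝔖(M)` over `Ψ(𝔖)`, for a monoid operad `M`. -/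
abbrev psiOver : Over (psi.obj symPointed.{u}) := psiSym.obj (monOpToPointed.obj M)

/-- The crossed interval monoid `Ψ^𝔖(M)`, for a monoid operad `M`: its multiplication is
`Ψ^𝔖(M) ⋊ Ψ^𝔖(M) = Ψ^𝔖(M ⋊ M) ⟶ Ψ^𝔖(M)`, and its unit is `∗ = Ψ^𝔖(∗) ⟶ Ψ^𝔖(M)`. -/
def toCrsMon : CrsMon.{u} where
  X := Over.mk (M.psiOver.hom ≫ symToWeyl.hom)
  mon :=
    { one := PresheafOver.homMk (fun a _ => M.unit.app a.unop.n ⟨⟩)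
        (fun φ _ => ((Operad.map_psiMap M.unit (𝟙 trivialOperad) φ.unop ⟨⟩)).trans
          (by rw [Category.id_comp]; rfl))
        (fun a _ => congrArg (fun g => Weyl.ofPerm (ULift.down g))
          (Operad.hom_congr M.unit_hom a.unop.n ⟨⟩))
      mul := PresheafOver.homMk (fun a x => M.mul.app a.unop.n x)
        (fun φ x => M.mul_psiMap φ.unop x.1 x.2)
        (fun a x => congrArg (fun g => Weyl.ofPerm (ULift.down g)) (M.mul_hom a.unop.n x))
      one_mul := PresheafOver.hom_ext fun a x => M.one_mul a.unop.n x.2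
      mul_one := PresheafOver.hom_ext fun a x => M.mul_one a.unop.n x.1
      mul_assoc := PresheafOver.hom_ext fun a x => M.mul_assoc a.unop.n x.1.1 x.1.2 x.2 }

/-- The structure map `Ψ^𝔖(M) ⟶ 𝔖` is a map of crossed interval monoids. -/
def toCrsMonHom : M.toCrsMon ⟶ symCrsMon :=
  Mon.Hom.mk' (M := M.toCrsMon) (N := symCrsMon) (Over.homMk M.psiOver.hom rfl)
    (PresheafOver.hom_ext fun a _ => Operad.hom_congr M.unit_hom a.unop.n ⟨⟩)
    (PresheafOver.hom_ext fun a x => M.mul_hom a.unop.n x)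

end MonOp

/-- The functor `Ψ̂ : MonOp ⥤ CrsMon_∇^{/𝔖}` induced by `Ψ^𝔖`. -/
def psiHat : MonOp.{u} ⥤ Over symCrsMon.{u} where
  obj M := Over.mk M.toCrsMonHom
  map {M N} f := Over.homMk
    (Mon.Hom.mk' (M := M.toCrsMon) (N := N.toCrsMon)
      (Over.homMk (psiSym.map (monOpToPointed.map f)).left
        ((Category.assoc _ _ _).symm.trans
          (congrArg (· ≫ symToWeyl.hom) (Over.w (psiSym.map (monOpToPointed.map f))))))
      (PresheafOver.hom_ext fun a _ => Operad.hom_congr (MonOp.map_unit f) a.unop.n ⟨⟩)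
      (PresheafOver.hom_ext fun a x => MonOp.map_mul f a.unop.n x.1 x.2))
    (Mon.Hom.ext (Over.OverMorphism.ext (Over.w (psiSym.map (monOpToPointed.map f)))))
  map_id _ := rfl
  map_comp _ _ := rfl

/-- The functor `CrsMon_∇^{/𝔖} ⥤ Set_∇^{/Ψ(𝔖)}` that forgets the monoid structures. -/
def forgetCrsMon : Over symCrsMon.{u} ⥤ Over (psi.obj symPointed.{u}) where
  obj G := Over.mk G.hom.hom.left
  map {G _} f := Over.homMk f.left.hom.left
    (congrArg (fun p : G.left ⟶ symCrsMon => p.hom.left) (Over.w f))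
  map_id _ := rfl
  map_comp _ _ := rfl

/-- On underlying interval sets over `Ψ(𝔖)`, the functor `Ψ̂` is `Ψ^𝔖`. -/
theorem psiHat_forget : psiHat.{u} ⋙ forgetCrsMon = monOpToPointed ⋙ psiSym := rfl

end CrossedInterval

/-! The point is that the operad composition of a monoid operad can be recovered from its
multiplications and its interval set structure. Taking the unit as the right outer factor in the
interchange law gives `γ(x; x₁y₁, …, xₙyₙ) = γ(x; x₁, …, xₙ) · γ(e; y₁, …, yₙ)`, with no reindexing
because the unit has trivial permutation. With all `xᵢ` equal to base points, this splits `γ(x; y₁,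
…, yₙ)` into `γ(x; e, …, e)` times `γ(e; y₁, …, yₙ)`. With `x = e`, it says that `γ(e; -)` is a
monoid homomorphism on the product of the `X(kᵢ)`, so the second factor is the product of the
elements `γ(e; e, …, yᵢ, …, e)`. The factor `γ(x; e, …, e)` is `φ^*(x)` for an active `φ`
(`psiMap_active`), and `γ(e; e, …, yᵢ, …, e)` is `ρᵢ^*(yᵢ)` for the inert projection `ρᵢ` to the
`i`-th block (`comp_pt_single`). The result is `Operad.comp_eq_prod`.

Full faithfulness follows. A map between values of the functor is already a family of functions that
respects products, units, all `φ^*` and the permutations, so by the product formula it respects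
compositions. The same argument applies to group operads. There the crossed interval group acts on
`∇` through its permutations, its crossed multiplication law is the compatibility of the
multiplication with `φ^*`, and the square of functors commutes definitionally.

For the left adjoint, the product formula makes sense in any crossed interval group over `𝔖`,
although it need not define an operad there. Every map to a group operad turns it into the actual
composition (`ToPsiGrp.app_comp`). Hence it suffices to identify elements that no map to a group
operad separates: on the quotient the formula gives a composition, and each axiom holds because it
holds in every target (`lift_ext`, `lift_comp`). Nothing has to be added freely, and maps out of the
quotient are by construction the maps to group operads. -/

namespace CrossedInterval

/-! ### Inert and active morphisms of `∇`. -/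

namespace Nabla

/-- The map `⟪m⟫ ⟶ ⟪n⟫` that sends the first `a` of the elements `1, …, m` to `-∞`, the last `b` of
them to `∞`, and the other ones bijectively to `1, …, n`. -/
def inert (a n b : ℕ) {m : ℕ} (h : a + n + b = m) : (⟨m⟩ : Nabla) ⟶ ⟨n⟩ :=
  -- Fibre sizes count the endpoints `±∞` themselves, hence `a + 1` and `b + 1`; for the same reason
  -- an active map has outer fibres of size `1`.
  Hom.ofCard ⟨m⟩ ⟨n⟩ (Fin.cons (a + 1) (Fin.snoc (α := fun _ => ℕ) (fun _ => 1) (b + 1)))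
    (by rw [sum_mid]; simp [mid, ← Fin.succ_last]; omega) (by simp) (by simp [← Fin.succ_last])

/-- The map `⟪m⟫ ⟶ ⟪n⟫` for which only `±∞` are mapped to `±∞`, and which has the given numbers
`k₁, …, kₙ`. -/
def active {n m : ℕ} (k : Fin n → ℕ) (h : ∑ i, k i = m) : (⟨m⟩ : Nabla) ⟶ ⟨n⟩ :=
  Hom.ofCard ⟨m⟩ ⟨n⟩ (Fin.cons 1 (Fin.snoc (α := fun _ => ℕ) k 1))
    (by rw [sum_mid]; simp [mid, ← Fin.succ_last]; omega) (by simp) (by simp [← Fin.succ_last])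

theorem k_inert (a n b : ℕ) {m : ℕ} (h : a + n + b = m) :
    Hom.k (inert a n b h) 0 = a ∧ Hom.k (inert a n b h) (Fin.last (n + 1)) = b ∧
      ∀ i, Hom.k (inert a n b h) (mid i) = 1 := by
  refine ⟨?_, ?_, fun i => ?_⟩
  · rw [Hom.k_zero, inert, Hom.card_ofCard]; simp
  · rw [Hom.k_last, inert, Hom.card_ofCard]; simp [← Fin.succ_last]
  · rw [Hom.k_mid, inert, Hom.card_ofCard]; simp [mid]

theorem k_active {n m : ℕ} (k : Fin n → ℕ) (h : ∑ i, k i = m) :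
    Hom.k (active k h) 0 = 0 ∧ Hom.k (active k h) (Fin.last (n + 1)) = 0 ∧
      ∀ i, Hom.k (active k h) (mid i) = k i := by
  refine ⟨?_, ?_, fun i => ?_⟩
  · rw [Hom.k_zero, active, Hom.card_ofCard]; simp
  · rw [Hom.k_last, active, Hom.card_ofCard]; simp [← Fin.succ_last]
  · rw [Hom.k_mid, active, Hom.card_ofCard]; simp [mid]

/-- The indices before `i`, equal to `i` and after `i` exhaust the sum. This is the arity equation
that makes the projection to the `i`-th block an inert map. -/
theorem sum_inert {n m : ℕ} (k : Fin n → ℕ) (h : ∑ i, k i = m) (i : Fin n) :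
    (∑ j, if j < i then k j else 0) + k i + (∑ j, if i < j then k j else 0) = m := by
  have : k i = ∑ j, if j = i then k j else 0 := by simp
  rw [this, ← Finset.sum_add_distrib, ← Finset.sum_add_distrib, ← h]
  refine Finset.sum_congr rfl fun j _ => ?_
  rcases lt_trichotomy j i with hij | rfl | hij
  · simp [hij, hij.ne, hij.not_gt]
  · simp
  · simp [hij, hij.ne', hij.not_gt]

/-- The map `⟪k₁ + ⋯ + kₙ⟫ ⟶ ⟪kᵢ⟫` that is bijective on the `i`-th block. -/
def block {n m : ℕ} (k : Fin n → ℕ) (h : ∑ i, k i = m) (i : Fin n) : (⟨m⟩ : Nabla) ⟶ ⟨k i⟩ :=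
  inert (∑ j, if j < i then k j else 0) (k i) (∑ j, if i < j then k j else 0) (sum_inert k h i)

end Nabla

/-! ### Operad compositions in terms of the maps `φ^*`. -/

namespace Operad

open Nabla

variable {X : Operad.{u}} (e : trivialOperad ⟶ X)

/-- Every middle number of an inert map is `1` and the base point in arity one is the operad
identity, so the inner composition is `x` by the unit law. The arities agree only propositionally,
hence the heterogeneous equalities. -/
theorem psiMap_inert (a n b : ℕ) {m : ℕ} (h : a + n + b = m) (x : X.obj n) :
    psiMap e (inert a n b h) x = X.comp₃ h (pt e 3) (pt e a) x (pt e b) := by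
  obtain ⟨h0, h1, h2⟩ := k_inert a n b h
  have hs : ∑ i : Fin n, Hom.k (inert a n b h) (mid i) = n := by simp [h2]
  refine X.comp₃_congr h0 hs h1 (Hom.sum_k (inert a n b h)) _ _ (pt_congr e h0) ?_ (pt_congr e h1)
  refine (X.comp_heq h2 _ (by simp) x hs (y' := fun _ => X.one) fun i => ?_).trans
    (heq_of_eq (X.comp_one (by simp) x))
  exact (pt_congr e (h2 i)).trans (heq_of_eq (pt_one e))

/-- Both outer numbers vanish, and `γ(e₃; e₀, -, e₀)` is the identity by `comp₃_pt_zero`. -/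
theorem psiMap_active {n m : ℕ} (k : Fin n → ℕ) (h : ∑ i, k i = m) (x : X.obj n) :
    psiMap e (active k h) x = X.comp k h x fun i => pt e (k i) := by
  obtain ⟨h0, h1, h2⟩ := k_active k h
  have hs : ∑ i : Fin n, Hom.k (active k h) (mid i) = m := by simp [h2, h]
  refine (X.comp₃_congr h0 hs h1 (Hom.sum_k (active k h)) (by simp) _ (pt_congr e h0) ?_ (pt_congr e h1)).trans
    (comp₃_pt_zero e _ _)
  exact X.comp_heq h2 _ _ x hs fun i => pt_congr e (h2 i)

/-- Base points are closed under composition, so `eₙ` can be written as a ternary composition that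
isolates the index `i`. By associativity the entries before `i` and those after `i` compose to base
points, and the entry at `i` is composed with the identity. What remains is the formula for an inert
map. -/
theorem comp_pt_single {n m : ℕ} (k : Fin n → ℕ) (h : ∑ i, k i = m) (i : Fin n)
    (z : ∀ j, X.obj (k j)) (hz : ∀ j, j ≠ i → z j = pt e (k j)) :
    X.comp k h (pt e n) z = psiMap e (block k h i) (z i) := by
  -- Indices start at `0`, so `i` elements precede `i` and `n - 1 - i` follow it.
  have hn : ∑ j, ![(i : ℕ), 1, n - 1 - i] j = n := by
    have := i.2; simp [Fin.sum_univ_three]; omega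
  have f0 : ∀ a : Fin i, flat ![(i : ℕ), 1, n - 1 - i] hn ⟨0, a⟩ = ⟨a, a.2.trans i.2⟩ := fun a =>
    Fin.ext (flat₃_zero _ a)
  have f1 : ∀ a : Fin 1, flat ![(i : ℕ), 1, n - 1 - i] hn ⟨1, a⟩ = i := fun a =>
    Fin.ext ((flat₃_one _ a).trans (by omega))
  have f2 : ∀ a : Fin (n - 1 - i), flat ![(i : ℕ), 1, n - 1 - i] hn ⟨2, a⟩ =
      ⟨i + 1 + a, by omega⟩ := fun a => Fin.ext (flat₃_two _ a)
  have hflat := flat_sum ![(i : ℕ), 1, n - 1 - i] hn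
  have g0 : ∑ a : Fin i, k (flat ![(i : ℕ), 1, n - 1 - i] hn ⟨0, a⟩) =
      ∑ j, if j < i then k j else 0 := by
    -- The function `k` is cut off to the indices before `i` and summed over all three blocks; only
    -- the first block contributes. The equation `g2` is obtained in the same way from the last
    -- block.
    have := hflat fun j => if j < i then k j else 0
    rw [← this, Fin.sum_univ_three]
    refine Eq.trans ?_ (congrArg₂ (· + ·) (congrArg₂ (· + ·) rfl
      (Finset.sum_eq_zero fun a _ => ?_).symm) (Finset.sum_eq_zero fun a _ => ?_).symm)
    · refine Finset.sum_congr rfl fun a _ => (if_pos ?_).symm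
      rw [f0]; exact a.2
    · exact if_neg (f1 a).not_lt
    · refine if_neg (not_lt.2 (le_of_le_of_eq (Fin.le_def.2 ?_) (f2 a).symm))
      change (i : ℕ) ≤ i + 1 + a
      omega
  have g1 : ∑ a : Fin 1, k (flat ![(i : ℕ), 1, n - 1 - i] hn ⟨1, a⟩) = k i := by
    simp only [f1]; simp
  have g2 : ∑ a : Fin (n - 1 - i), k (flat ![(i : ℕ), 1, n - 1 - i] hn ⟨2, a⟩) =
      ∑ j, if i < j then k j else 0 := by
    have := hflat fun j => if i < j then k j else 0
    rw [← this, Fin.sum_univ_three]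
    have e0 : ∀ {a b c d : ℕ}, a = 0 → b = 0 → d = c → d = a + b + c := by intros; omega
    refine e0 (Finset.sum_eq_zero fun a _ => ?_) (Finset.sum_eq_zero fun a _ => ?_) ?_
    · exact if_neg (not_lt.2 ((f0 a).trans_le (Fin.le_def.2 a.2.le)))
    · exact if_neg (f1 a).not_gt
    · refine Finset.sum_congr rfl fun a _ => (if_pos (lt_of_lt_of_eq (Fin.lt_def.2 ?_)
        (f2 a).symm)).symm
      change (i : ℕ) < i + 1 + a
      omega
  have hs := sum_inert k h i
  -- Here `eₙ` becomes `γ(e₃; e_i, e₁, e_{n-1-i})`, and associativity compares the two sides entry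
  -- by entry under `e₃`.
  rw [block, psiMap_inert, ← comp_pt e _ hn, X.assoc _ _ k h
    ![∑ j, if j < i then k j else 0, k i, ∑ j, if i < j then k j else 0]
    (by simp [Fin.sum_univ_three, hs]) (by intro t; fin_cases t; exacts [g0, g1, g2])]
  unfold comp₃
  refine congrArg _ (funext fun t => ?_)
  fin_cases t
  -- The index `i` does not occur in an outer block, so all entries there are base points.
  · exact comp_pt' e _ g0 _ fun a => hz _ fun h => by
      have := congrArg Fin.val ((f0 a).symm.trans h); have := a.2; simp at *; omega
  · refine (X.comp_idx k z _ (g := fun _ => i) f1 g1 (by simp)).trans ?_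
    exact (congrArg (fun w => X.comp (fun _ => k i) (by simp) w fun _ => z i) (pt_one e)).trans
      (X.one_comp _ (z i))
  · exact comp_pt' e _ g2 _ fun a => hz _ fun h => by
      have := congrArg Fin.val ((f2 a).symm.trans h); have := a.2; simp at *; omega

/-- A composition in an operad with interchange law is a product of values of the maps `φ^*`. -/
theorem comp_eq_prod [∀ n, Monoid (X.obj n)] (ρ : X ⟶ symOperad) (he : ∀ n, pt e n = 1)
    (hρ : ∀ n, perm ρ (1 : X.obj n) = 1)
    (hX : ∀ {n m : ℕ} (k : Fin n → ℕ) (h : ∑ i, k i = m) (x y : X.obj n) (xs ys : ∀ i, X.obj (k i)),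
      X.comp k h (x * y) (fun i => xs i * ys i) =
        X.comp (fun i => k ((perm ρ y)⁻¹ i)) (sum_perm _ h) x
          (fun i => xs ((perm ρ y)⁻¹ i)) * X.comp k h y ys)
    {n m : ℕ} (k : Fin n → ℕ) (h : ∑ i, k i = m) (x : X.obj n) (y : ∀ i, X.obj (k i)) :
    X.comp k h x y = psiMap e (active k h) x *
      ((List.finRange n).map fun i => psiMap e (block k h i) (y i)).prod := by
  -- Interchange with the unit as right outer factor: its permutation is trivial, so the blocks are
  -- not reindexed.
  have h1 : ∀ (x : X.obj n) (xs ys : ∀ i, X.obj (k i)),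
      X.comp k h x (fun i => xs i * ys i) = X.comp k h x xs * X.comp k h 1 ys := fun x xs ys => by
    have := hX k h x 1 xs ys
    rw [mul_one] at this
    refine this.trans (congrArg (· * _) ?_)
    exact X.comp_idx k xs x (g := fun i => i) (fun i => by rw [hρ]; rfl) _ h
  -- For `x = 1` the identity `h1` says that composing with the unit is multiplicative in the tuple
  -- of inner operations.
  let Φ : (∀ i, X.obj (k i)) →* X.obj m :=
    { toFun := fun y => X.comp k h 1 y
      map_one' := by rw [← he n, ← he m]; exact comp_pt' e k h _ fun i => (he _).symm
      map_mul' := fun y z => h1 1 y z }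
  have h2 : Φ y = ((List.finRange n).map fun i => psiMap e (block k h i) (y i)).prod := by
    -- A tuple is the product of its single-entry tuples. These commute with each other in the
    -- product monoid, so the product may be taken in list order and pushed through `Φ`.
    conv_lhs => rw [← Finset.noncommProd_mulSingle y]
    have := Finset.noncommProd_toFinset (List.finRange n) (fun i => Pi.mulSingle i (y i))
      (fun i _ j _ _ => Pi.mulSingle_apply_commute y i j) (List.nodup_finRange n)
    simp only [List.toFinset_finRange] at this
    rw [this, map_list_prod, List.map_map]
    refine congrArg List.prod (List.map_congr_left fun i _ => ?_)
    refine Eq.trans ?_ ((comp_pt_single e k h i (Pi.mulSingle i (y i)) fun j hj => ?_).trans ?_)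
    · rw [he]; rfl
    · rw [he, Pi.mulSingle_eq_of_ne hj]
    · rw [Pi.mulSingle_eq_same]
  rw [← h2, psiMap_active]
  -- Each `yᵢ` is written as base point times `yᵢ`, which separates the outer operation from the
  -- inner ones.
  have := h1 x (fun i => pt e (k i)) y
  simp only [he, one_mul] at this ⊢
  exact this

end Operad

open Nabla

/-! ### Full faithfulness of `Ψ̂` on monoid operads. -/

namespace MonOp

variable (M : MonOp.{u})

/-- The monoid structure on the set of operations of arity `n` of a monoid operad. -/
@[reducible] def monoid (n : ℕ) : Monoid (M.X.left.obj n) where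
  mul x y := M.mul.app n (x, y)
  one := M.unit.app n ⟨⟩
  mul_assoc := M.mul_assoc n
  one_mul := M.one_mul n
  mul_one := M.mul_one n

attribute [local instance] monoid

/-- The required interchange law is the statement that the multiplication `M ⋊ M ⟶ M` preserves
compositions, since the composition of `M ⋊ M` carries the reindexing by the permutation of the
second factor. -/
theorem comp_eq_prod {n m : ℕ} (k : Fin n → ℕ) (h : ∑ i, k i = m) (x : M.X.left.obj n)
    (y : ∀ i, M.X.left.obj (k i)) :
    M.X.left.comp k h x y = Operad.psiMap M.unit (active k h) x *
      ((List.finRange n).map fun i => Operad.psiMap M.unit (block k h i) (y i)).prod :=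
  Operad.comp_eq_prod M.unit M.X.hom (fun _ => rfl)
    (fun n => congrArg ULift.down (Operad.hom_congr M.unit_hom n ⟨⟩))
    (fun k h x y xs ys => (M.mul.map_comp k h (x, y) fun i => (xs i, ys i)).symm) k h x y

/-- The map of operads given by a family of functions that is compatible with the multiplications
and with the structures of interval sets. -/
def operadHom {M N : MonOp.{u}} (f : ∀ n, M.X.left.obj n → N.X.left.obj n)
    (h1 : ∀ n, f n (M.unit.app n ⟨⟩) = N.unit.app n ⟨⟩)
    (hm : ∀ n x y, f n (M.mul.app n (x, y)) = N.mul.app n (f n x, f n y))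
    (hf : ∀ {a b : Nabla} (φ : a ⟶ b) (x : M.X.left.obj b.n),
      f a.n (Operad.psiMap M.unit φ x) = Operad.psiMap N.unit φ (f b.n x)) :
    M.X.left ⟶ N.X.left where
  app := f
  -- The operad identity is the monoid unit in arity one, so preservation of units covers it.
  map_one := (congrArg (f 1) M.unit.map_one.symm).trans ((h1 1).trans N.unit.map_one)
  map_comp {n m} k h x y := by
    -- All factors of the product formula live in the total arity `m`, so one monoid homomorphism
    -- carries the whole product across.
    let F : M.X.left.obj m →* N.X.left.obj m := ⟨⟨f m, h1 m⟩, hm m⟩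
    refine (congrArg F (M.comp_eq_prod k h x y)).trans ?_
    rw [_root_.map_mul, map_list_prod, List.map_map, N.comp_eq_prod]
    exact congrArg₂ (· * ·) (hf (active k h) x) (congrArg List.prod
      (List.map_congr_left fun i _ => hf (block k h i) (y i)))

end MonOp

theorem PresheafOver.congr_app {A : Type v} [SmallCategory A] {G : CrossedGroup.{v, u} A}
    {X Y : Over G.X} {f g : X ⟶ Y} (h : f = g) (a : Aᵒᵖ) (x : X.left.obj a) :
    f.left.app a x = g.left.app a x := by rw [h]

/-- `Ψ̂` keeps the underlying functions in every arity, and these determine a map of operads. -/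
instance psiHat_faithful : psiHat.{u}.Faithful where
  map_injective {M N _ _} h := Mon.Hom.ext (Over.OverMorphism.ext (Operad.hom_ext fun n x =>
    PresheafOver.congr_app (congrArg
      (fun p : psiHat.obj M ⟶ psiHat.obj N => p.left.hom) h) (op ⟨n⟩) x))

/-- The function in arity `n` of a map between values of `Ψ̂`. -/
def psiHatApp {M N : MonOp.{u}} (f : psiHat.obj M ⟶ psiHat.obj N) (n : ℕ) (x : M.X.left.obj n) :
    N.X.left.obj n :=
  f.left.hom.left.app (op ⟨n⟩) x

theorem psiHatApp_unit {M N : MonOp.{u}} (f : psiHat.obj M ⟶ psiHat.obj N) (n : ℕ) :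
    psiHatApp f n (M.unit.app n ⟨⟩) = N.unit.app n ⟨⟩ :=
  PresheafOver.congr_app f.left.isMonHom_hom.one_hom (op ⟨n⟩) PUnit.unit

theorem psiHatApp_mul {M N : MonOp.{u}} (f : psiHat.obj M ⟶ psiHat.obj N) (n : ℕ)
    (x y : M.X.left.obj n) :
    psiHatApp f n (M.mul.app n (x, y)) = N.mul.app n (psiHatApp f n x, psiHatApp f n y) :=
  PresheafOver.congr_app f.left.isMonHom_hom.mul_hom (op ⟨n⟩)
    (show M.X.left.obj n × M.X.left.obj n from (x, y))

/-- Compatibility with permutations is read off from the commuting triangle over `symCrsMon`. -/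
theorem psiHatApp_hom {M N : MonOp.{u}} (f : psiHat.obj M ⟶ psiHat.obj N) (n : ℕ)
    (x : M.X.left.obj n) : N.X.hom.app n (psiHatApp f n x) = M.X.hom.app n x :=
  ConcreteCategory.congr_hom (NatTrans.congr_app (congrArg
    (fun p : (psiHat.obj M).left ⟶ symCrsMon => p.hom.left) (Over.w f)) (op ⟨n⟩)) x

/-- The only property of the preimage that is not immediate is preservation of operad compositions,
which `operadHom` derives from naturality and multiplicativity. -/
instance psiHat_full : psiHat.{u}.Full where
  map_surjective {M N} f := by
    let g : M.X.left ⟶ N.X.left := MonOp.operadHom (psiHatApp f) (psiHatApp_unit f)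
      (psiHatApp_mul f) (fun {a b} φ x => PresheafOver.nat_app f.left.hom.left φ.op x)
    refine ⟨Mon.Hom.mk' (M := M) (N := N)
      (Over.homMk g (Operad.hom_ext (psiHatApp_hom f)))
      (Over.OverMorphism.ext (Operad.hom_ext fun n _ => psiHatApp_unit f n))
      (Over.OverMorphism.ext (Operad.hom_ext fun n x => psiHatApp_mul f n x.1 x.2)), ?_⟩
    exact Over.OverMorphism.ext (Mon.Hom.ext (PresheafOver.hom_ext fun _ _ => rfl))

/-! ### Group operads as crossed interval groups -/

namespace GrpOp

variable (G : GrpOp.{u})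

/-- The crossed interval group given by a group operad. -/
def toCrossed : CrossedGroup.{0, u} Nabla where
  X := psi.obj (Under.mk G.toMonOp.unit)
  group a := G.group a.unop.n
  act g φ := symAct (G.hom.app _ g) φ
  one_act φ := (congrArg (fun g => symAct g φ) (congrArg ULift.up (G.perm_one _))).trans
    (symAct_one φ)
  mul_act g h φ := (congrArg (fun g => symAct g φ) (G.hom_mul g h)).trans (symAct_mul _ _ φ)
  act_comp {a b c} g φ ψ := by
    refine (symAct_comp _ φ ψ).trans ?_
    refine congrArg (fun g => symAct g ψ ≫ _) ?_
    -- The structure map to `𝔖` sends base points to units and therefore commutes with `φ^*`; this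
    -- transports the law from `𝔖`.
    exact ((Operad.map_psiMap G.hom G.toMonOp.unit φ g).trans
      (congrArg (fun e => Operad.psiMap e φ _) G.toMonOp.unit_hom)).symm
  -- The crossed multiplication law is exactly the naturality of the multiplication on `Ψ(G) ⋊
  -- Ψ(G)`.
  map_mul φ g h := (G.toMonOp.mul_psiMap φ g h).symm

/-- The structure map of a group operad, as a map of crossed interval groups. -/
def toCrossedHom : G.toCrossed ⟶ symCrossed.{u} where
  hom := psi.map (Under.homMk G.hom G.toMonOp.unit_hom : Under.mk G.toMonOp.unit ⟶ symPointed)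
  map_mul g h := G.hom_mul g h
  act_hom _ _ := rfl

end GrpOp

/-- The functor `GrpOp ⥤ CrsGrp_∇^{/𝔖}` induced by `Ψ̂`. -/
def psiGrp : GrpOp.{u} ⥤ Over symCrossed.{u} where
  obj G := Over.mk G.toCrossedHom
  map {G H} f := Over.homMk
    { hom := psi.map (Under.homMk f.hom (MonOp.map_unit (grpOpToMonOp.map f)) :
        Under.mk G.toMonOp.unit ⟶ Under.mk H.toMonOp.unit)
      map_mul := f.map_mul
      act_hom := fun g φ => congrArg (fun g => symAct g φ) (Operad.hom_congr f.w _ g) }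
    (CrossedGroup.Hom.ext (by ext a x; exact Operad.hom_congr f.w a.unop.n x))
  map_id _ := rfl
  map_comp _ _ := rfl

/-- The square of `psiGrp` and `Ψ̂` commutes. -/
def psiGrpIso : psiGrp.{u} ⋙ crsGrpToCrsMon ≅ grpOpToMonOp ⋙ psiHat := Iso.refl _

/-- The units of a group operad, as a map `∗ ⟶ G` of operads. -/
def GrpOp.unit (G : GrpOp.{u}) : trivialOperad ⟶ G.X := G.toMonOp.unit

/-- The product is formed in the given groups of `G`, so that group homomorphisms can be pushed
through it; the interchange law is part of the structure. -/
theorem GrpOp.comp_eq_prod (G : GrpOp.{u}) {n m : ℕ} (k : Fin n → ℕ) (h : ∑ i, k i = m)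
    (x : G.X.obj n) (y : ∀ i, G.X.obj (k i)) :
    G.X.comp k h x y = Operad.psiMap G.unit (active k h) x *
      ((List.finRange n).map fun i =>
        Operad.psiMap G.unit (block k h i) (y i)).prod :=
  Operad.comp_eq_prod G.unit G.hom (fun _ => rfl) G.perm_one G.comp_mul k h x y

/-! ### Maps from crossed interval groups to group operads. -/

namespace ToPsiGrp

variable {G : Over symCrossed.{u}} {H : GrpOp.{u}} (f : G ⟶ psiGrp.obj H)

/-- The group homomorphism in arity `n` of a map to a group operad. -/
def app (n : ℕ) : G.left.X.obj (op ⟨n⟩) →* H.X.obj n :=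
  MonoidHom.mk' (fun x => f.left.hom.app (op ⟨n⟩) x) f.left.map_mul

theorem app_map {m n : ℕ} (φ : (⟨m⟩ : Nabla) ⟶ ⟨n⟩) (x : G.left.X.obj (op ⟨n⟩)) :
    app f m (G.left.X.map φ.op x) = Operad.psiMap H.unit φ (app f n x) :=
  PresheafOver.nat_app f.left.hom φ.op x

theorem hom_app (n : ℕ) (x : G.left.X.obj (op ⟨n⟩)) :
    H.hom.app n (app f n x) = G.hom.hom.app (op ⟨n⟩) x :=
  ConcreteCategory.congr_hom (NatTrans.congr_app (congrArg
    (fun p : G.left ⟶ symCrossed => p.hom) (Over.w f)) (op ⟨n⟩)) x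

theorem ext {f g : G ⟶ psiGrp.obj H} (h : ∀ n x, app f n x = app g n x) : f = g :=
  Over.OverMorphism.ext (CrossedGroup.Hom.ext (by ext a x; exact h a.unop.n x))

variable (G) in
/-- The product of `φ^*(x)` and of the `ρᵢ^*(yᵢ)`, with `φ` active and `ρᵢ` the projection to the
`i`-th block, which every map to a group operad sends to a
composition. -/
def comp {n m : ℕ} (k : Fin n → ℕ) (h : ∑ i, k i = m) (x : G.left.X.obj (op ⟨n⟩))
    (y : ∀ i, G.left.X.obj (op ⟨k i⟩)) : G.left.X.obj (op ⟨m⟩) :=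
  G.left.X.map (active k h).op x *
    ((List.finRange n).map fun i => G.left.X.map (block k h i).op (y i)).prod

/-- A map respects products and all `φ^*`, so it carries the formula in `G` to the same formula in
`H`, where it computes the composition. No operad axiom is needed in `G`. This drives both fullness
and the left adjoint. -/
theorem app_comp {n m : ℕ} (k : Fin n → ℕ) (h : ∑ i, k i = m) (x : G.left.X.obj (op ⟨n⟩))
    (y : ∀ i, G.left.X.obj (op ⟨k i⟩)) :
    app f m (comp G k h x y) = H.X.comp k h (app f n x) fun i => app f (k i) (y i) := by
  rw [comp, map_mul, map_list_prod, List.map_map, H.comp_eq_prod]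
  exact congrArg₂ (· * ·) (app_map f _ x) (congrArg List.prod
    (List.map_congr_left fun i _ => app_map f _ (y i)))

end ToPsiGrp

instance psiGrp_faithful : psiGrp.{u}.Faithful where
  map_injective {G H _ _} h := GrpOp.Hom.ext (Operad.hom_ext fun n x =>
    congrArg (fun p : psiGrp.obj G ⟶ psiGrp.obj H => ToPsiGrp.app p n x) h)

instance psiGrp_full : psiGrp.{u}.Full where
  map_surjective {G H} f := by
    -- When the source comes from a group operad, the product formula is its own composition:
    -- `app_comp` is applied to the identity map.
    have hc : ∀ {n m : ℕ} (k : Fin n → ℕ) (h : ∑ i, k i = m) (x : G.X.obj n)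
        (y : ∀ i, G.X.obj (k i)), ToPsiGrp.comp (psiGrp.obj G) k h x y = G.X.comp k h x y :=
      fun k h x y => ToPsiGrp.app_comp (𝟙 (psiGrp.obj G)) k h x y
    exact ⟨{
      hom :=
        { app := fun n => ToPsiGrp.app f n
          map_one := by
            refine (congrArg (ToPsiGrp.app f 1) G.one_eq.symm).trans ?_
            exact ((ToPsiGrp.app f 1).map_one).trans H.one_eq
          map_comp := fun k h x y =>
            (congrArg (ToPsiGrp.app f _) (hc k h x y).symm).trans (ToPsiGrp.app_comp f k h x y) }
      map_mul := fun x y => (ToPsiGrp.app f _).map_mul x y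
      w := Operad.hom_ext (ToPsiGrp.hom_app f) }, ToPsiGrp.ext fun _ _ => rfl⟩

/-- The group operad `𝔖`. -/
def symGrpOp : GrpOp.{u} where
  X := symOperad
  group n := symGroup n
  hom := 𝟙 _
  hom_mul _ _ := rfl
  comp_mul k h x y xs ys := congrArg ULift.up (permComp_mul k h x.down y.down
    (fun i => (xs i).down) (fun i => (ys i).down) _)

/-- The map to the group operad `𝔖`. -/
def toSymGrpOp (G : Over symCrossed.{u}) : G ⟶ psiGrp.obj symGrpOp :=
  Over.homMk
    { hom := G.hom.hom
      map_mul := G.hom.map_mul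
      act_hom := G.hom.act_hom }
    (CrossedGroup.Hom.ext (by ext a x; rfl))

/-! ### The left adjoint -/

namespace OperadicQuotient

open ToPsiGrp

variable (G : Over symCrossed.{u})

/-- The congruence relation that identifies the elements that have the same image under all maps
to group operads. -/
def con (n : ℕ) : Con (G.left.X.obj (op ⟨n⟩)) where
  -- Although all group operads are quantified over, the relation is a proposition, so the quotient
  -- stays in the same universe.
  r x y := ∀ (H : GrpOp.{u}) (f : G ⟶ psiGrp.obj H), app f n x = app f n y
  iseqv := ⟨fun _ _ _ => rfl, fun h H f => (h H f).symm, fun h h' H f => (h H f).trans (h' H f)⟩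
  mul' h h' H f := by rw [map_mul, map_mul, h, h']

variable {G}

/-- The map on the quotient induced by a map to a group operad. -/
def lift {H : GrpOp.{u}} (f : G ⟶ psiGrp.obj H) (n : ℕ) : (con G n).Quotient →* H.X.obj n :=
  (con G n).lift (app f n) fun _ _ h => h H f

theorem lift_mk {H : GrpOp.{u}} (f : G ⟶ psiGrp.obj H) (n : ℕ) (x : G.left.X.obj (op ⟨n⟩)) :
    lift f n x = app f n x := rfl

/-- By the choice of the congruence, the lifts jointly separate points. Every equation in the
quotient is verified through this test in group operads. -/
theorem lift_ext {n : ℕ} {x y : (con G n).Quotient}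
    (h : ∀ (H : GrpOp.{u}) (f : G ⟶ psiGrp.obj H), lift f n x = lift f n y) : x = y := by
  induction x using Con.induction_on
  induction y using Con.induction_on
  exact (Con.eq _).2 h

theorem lift_out {H : GrpOp.{u}} (f : G ⟶ psiGrp.obj H) (n : ℕ) (x : (con G n).Quotient) :
    app f n (Quotient.out x) = lift f n x :=
  congrArg (lift f n) (Quotient.out_eq x)

/-- The composition of the quotient. -/
noncomputable def comp {n m : ℕ} (k : Fin n → ℕ) (h : ∑ i, k i = m) (x : (con G n).Quotient)
    (y : ∀ i, (con G (k i)).Quotient) : (con G m).Quotient :=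
  -- The choice of representatives does not matter: the image of this element under each map to a
  -- group operad depends only on the classes, by `app_comp`.
  ((ToPsiGrp.comp G k h (Quotient.out x) fun i => Quotient.out (y i) : G.left.X.obj (op ⟨m⟩)) :
    (con G m).Quotient)

/-- Together with `lift_ext` this characterizes the composition of the quotient and reduces its
axioms to those of the targets. -/
theorem lift_comp {H : GrpOp.{u}} (f : G ⟶ psiGrp.obj H) {n m : ℕ} (k : Fin n → ℕ)
    (h : ∑ i, k i = m) (x : (con G n).Quotient) (y : ∀ i, (con G (k i)).Quotient) :
    lift f m (comp k h x y) = H.X.comp k h (lift f n x) fun i => lift f (k i) (y i) := by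
  rw [comp, lift_mk, app_comp]
  simp only [lift_out]

theorem lift_one {H : GrpOp.{u}} (f : G ⟶ psiGrp.obj H) : lift f 1 1 = H.X.one :=
  (map_one (lift f 1)).trans H.one_eq

variable (G)

/-- The underlying operad of the quotient. -/
noncomputable def operad : Operad.{u} where
  obj n := (con G n).Quotient
  one := 1
  comp k h x y := comp k h x y
  -- Each axiom becomes, after an arbitrary lift, the same axiom in `H`.
  one_comp h x := lift_ext fun H f => by
    rw [lift_comp, lift_one]; exact H.X.one_comp h _
  comp_one h x := lift_ext fun H f => by
    rw [lift_comp]; simp only [lift_one]; exact H.X.comp_one h _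
  assoc k h l hl q hq hi x y z := lift_ext fun H f => by
    simp only [lift_comp]; exact H.X.assoc k h l hl q hq hi _ _ _

instance group (n : ℕ) : Group ((operad G).obj n) :=
  inferInstanceAs (Group (con G n).Quotient)

variable {G}

/-- The map of operads on the quotient induced by a map to a group operad. -/
noncomputable def liftHom {H : GrpOp.{u}} (f : G ⟶ psiGrp.obj H) : operad G ⟶ H.X where
  app n := lift f n
  map_one := lift_one f
  map_comp k h x y := lift_comp f k h x y

/-- On representatives both sides are the structure map of `G` to `𝔖`. Thus the permutation of a
class can be computed in any target, and every lift is a map over `𝔖`. -/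
theorem liftHom_hom {H : GrpOp.{u}} (f : G ⟶ psiGrp.obj H) :
    liftHom f ≫ H.hom = liftHom (toSymGrpOp G) := by
  refine Operad.hom_ext fun n x => ?_
  induction x using Con.induction_on with | H x => exact hom_app f n x

variable (G)

/-- The quotient as a group operad. -/
noncomputable def grpOp : GrpOp.{u} where
  X := operad G
  hom := liftHom (toSymGrpOp G)
  hom_mul {n} x y := map_mul (lift (toSymGrpOp G) n) x y
  comp_mul {n m} k h x y xs ys := lift_ext fun H f => by
    -- The interchange law is tested in `H`, where the reindexing uses the permutation of the lifted
    -- element; it has to be identified with the one in the quotient.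
    have hp : Operad.perm H.hom (lift f n y) = Operad.perm (liftHom (toSymGrpOp G)) y :=
      congrArg ULift.down (Operad.hom_congr (liftHom_hom f) n y)
    refine (lift_comp f k h (x * y) fun i => xs i * ys i).trans ?_
    refine Eq.trans ?_ (map_mul (lift f m) _ _).symm
    refine Eq.trans ?_ (congrArg₂ (· * ·) (lift_comp f _ _ x _) (lift_comp f k h y ys)).symm
    refine (congrArg₂ (H.X.comp k h) (map_mul (lift f n) x y)
      (funext fun i => map_mul (lift f (k i)) (xs i) (ys i))).trans ?_
    refine (H.comp_mul k h _ _ _ _).trans (congrArg (· * _) ?_)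
    exact H.X.comp_idx k (fun i => lift f (k i) (xs i)) _ (fun i => congrArg (fun σ : Equiv.Perm (Fin n) => σ⁻¹ i) hp) _ _

/-- The map to the quotient. -/
noncomputable def toGrpOp : G ⟶ psiGrp.obj (grpOp G) :=
  Over.homMk
    { hom :=
        { app := fun a => TypeCat.ofHom fun x => ((x : G.left.X.obj a) : (con G a.unop.n).Quotient)
          naturality := fun a b φ => by
            ext x
            refine lift_ext fun H f => ?_
            -- After a lift, both sides of the naturality square become `φ^*` in `H` applied to the
            -- image of `x`. The base points agree because lifts preserve units.
            refine (app_map f φ.unop x).trans ?_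
            refine Eq.trans ?_ (Operad.map_psiMap (liftHom f) _ φ.unop _).symm
            refine congrArg (fun e => Operad.psiMap e φ.unop (app f a.unop.n x)) ?_
            exact Operad.hom_ext fun n _ => (map_one (lift f n)).symm }
      map_mul := fun _ _ => rfl
      act_hom := fun g φ => G.hom.act_hom g φ }
    (CrossedGroup.Hom.ext (by ext a x; rfl))

variable {G}

/-- The map of group operads on the quotient induced by a map to a group operad. -/
noncomputable def desc {H : GrpOp.{u}} (f : G ⟶ psiGrp.obj H) : grpOp G ⟶ H where
  hom := liftHom f
  map_mul x y := map_mul (lift f _) x y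
  w := liftHom_hom f

theorem toGrpOp_desc {H : GrpOp.{u}} (f : G ⟶ psiGrp.obj H) :
    toGrpOp G ≫ psiGrp.map (desc f) = f :=
  ToPsiGrp.ext fun _ _ => rfl

/-- Every class has a representative in `G`, so a map out of the quotient is determined by its
restriction along `toGrpOp`. -/
theorem hom_ext {H : GrpOp.{u}} {f g : grpOp G ⟶ H}
    (h : toGrpOp G ≫ psiGrp.map f = toGrpOp G ≫ psiGrp.map g) : f = g := by
  refine GrpOp.Hom.ext (Operad.hom_ext fun n x => ?_)
  induction x using Con.induction_on with
  | H x => exact congrArg (fun p => ToPsiGrp.app p n x) h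

/-- The maps out of the quotient are the maps to group operads. -/
noncomputable def homEquiv (G : Over symCrossed.{u}) (H : GrpOp.{u}) :
    (grpOp G ⟶ H) ≃ (G ⟶ psiGrp.obj H) where
  toFun f := toGrpOp G ≫ psiGrp.map f
  invFun := desc
  left_inv _ := hom_ext (toGrpOp_desc _)
  right_inv := toGrpOp_desc

end OperadicQuotient

/-- The group operad `grpOp G` represents the maps from `G` to values of `psiGrp`, naturally in the
target. This suffices, as functoriality of the left adjoint is then determined by the bijections. -/
instance psiGrp_isRightAdjoint : psiGrp.{u}.IsRightAdjoint :=
  (Adjunction.adjunctionOfEquivLeft OperadicQuotient.homEquiv fun _ _ _ _ _ => by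
    simp [OperadicQuotient.homEquiv]).isRightAdjoint

end CrossedInterval

theorem mainTheorem1 :
    CrossedInterval.psiHat.{u}.Full ∧ CrossedInterval.psiHat.{u}.Faithful ∧
      ∃ F : CrossedInterval.GrpOp.{u} ⥤ Over CrossedInterval.symCrossed.{u},
        Nonempty (F ⋙ CrossedInterval.crsGrpToCrsMon ≅
          CrossedInterval.grpOpToMonOp ⋙ CrossedInterval.psiHat) ∧
        F.Full ∧ F.Faithful ∧ F.IsRightAdjoint :=
  ⟨CrossedInterval.psiHat_full, CrossedInterval.psiHat_faithful, CrossedInterval.psiGrp,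
    ⟨CrossedInterval.psiGrpIso⟩, CrossedInterval.psiGrp_full, CrossedInterval.psiGrp_faithful,
    CrossedInterval.psiGrp_isRightAdjoint⟩
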